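/- Let $M$ be a smooth manifold of dimension $n$ with a flat torsion-free connection $\nabla$ and a Riemannian metric $\langle\;,\;\rangle$ with Levi-Civita connection $D$. Let $\gamma_XY=D_XY-\nabla_XY$ be the difference tensor and $\gamma^*$ its adjoint, $\langle\gamma^*_XY,Z\rangle=\langle Y,\gamma_XZ\rangle$. For a local orthonormal frame $(E_i)$ put $\mathrm{tr}_{\langle\,,\rangle}(\gamma)=\sum_i\gamma_{E_i}E_i$, $\mathrm{tr}_{\langle\,,\rangle}(\gamma^*)=\sum_i\gamma^*_{E_i}E_i$, and define the first Koszul form $\alpha(X)=\langle\mathrm{tr}_{\langle\,,\rangle}(\gamma^*),X\rangle$ and the adjoint Koszul form $\xi(X)=\langle\mathrm{tr}_{\langle\,,\rangle}(\gamma),X\rangle$. Let $\pi_1:TM\to M$ be the projection, and let $X^h$ and $X^v$ be the horizontal lift with respect to $\nabla$ and the vertical lift to $TM$ of a vector field $X$. On $TM$ consider the almost complex structure $J_1X^h=X^v$, $J_1X^v=-X^h$ and the metric $g_1$ with $g_1(X^h,Y^h)=g_1(X^v,Y^v)=\langle X,Y\rangle\circ\pi_1$, $g_1(X^h,Y^v)=0$.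 Let $\omega=g_1(J_1\cdot,\cdot)$, let $\nabla^{LC}$ be the Levi-Civita connection of $g_1$, let $d^*\omega=-\sum_i(\nabla^{LC}_{F_i}\omega)(F_i,\cdot)$ for a local $g_1$-orthonormal frame $(F_i)$ of $TM$, and let $\theta_1=-d^*\omega\circ J_1$ be the Lee form of $(TM,J_1,g_1)$. One calls $(TM,J_1,g_1)$ balanced if $\theta_1=0$ and locally conformally balanced if $d\theta_1=0$. Then: 1. $\theta_1=\pi_1^*(\alpha-\xi)$. 2. $(TM,J_1,g_1)$ is balanced if and only if $\alpha=\xi$, and also if and only if $\mathrm{tr}_{\langle\,,\rangle}(\gamma^*-\gamma)=0$. 3. $(TM,J_1,g_1)$ is locally conformally balanced if and only if $d\xi=0$. -/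

import Mathlib

open Bundle FiberBundle
open scoped Manifold ContDiff

noncomputable section

namespace AffineRiemann

/-! ### Notions on an arbitrary manifold

A (pseudo-)metric is a field `g` of bilinear forms on the tangent spaces, a 1-form is a field of
functions on the tangent spaces.  As everywhere in Mathlib, a connection `D` is written so that
`D Y x v` is `(D_v Y)(x)`, and `extend F v` is a smooth local vector field with value `v` at `x`. -/

section Generic

variable {F : Type*} [NormedAddCommGroup F] [NormedSpace ℝ F]
  {H : Type*} [TopologicalSpace H] (I : ModelWithCorners ℝ F H)
  {N : Type*} [TopologicalSpace N] [ChartedSpace H N]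

/-- Fields of bilinear forms on the tangent spaces. -/
abbrev BilinField (N : Type*) [TopologicalSpace N] [ChartedSpace H N] :=
  (x : N) → TangentSpace I x →L[ℝ] TangentSpace I x →L[ℝ] ℝ

/-- Fields of endomorphisms of the tangent spaces. -/
abbrev EndField (N : Type*) [TopologicalSpace N] [ChartedSpace H N] :=
  (x : N) → TangentSpace I x →L[ℝ] TangentSpace I x

/-- 1-forms. -/
abbrev OneForm (N : Type*) [TopologicalSpace N] [ChartedSpace H N] :=
  (x : N) → TangentSpace I x → ℝ

variable {I}

/-- `e` is an orthonormal family of `dim N` vectors of `T_x N`, that is, an orthonormal basis. -/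
def IsOrthonormalAt (g : BilinField I N) (x : N)
    (e : Fin (Module.finrank ℝ F) → TangentSpace I x) : Prop :=
  ∀ i j, g x (e i) (e j) = if i = j then 1 else 0

/-- An orthonormal basis of `T_x N` for `g`. -/
def orthonormalBasisAt (g : BilinField I N) (x : N) :
    Fin (Module.finrank ℝ F) → TangentSpace I x :=
  Classical.epsilon (IsOrthonormalAt g x)

variable [IsManifold I 1 N]

/-- `D` is the Levi-Civita connection of `g`: a covariant derivative on the tangent bundle which is
torsion free and for which `g` is parallel. -/
structure IsLeviCivita (g : BilinField I N)
    (D : (Π x : N, TangentSpace I x) → (Π x : N, TangentSpace I x →L[ℝ] TangentSpace I x)) :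
    Prop where
  isCovariantDerivative : IsCovariantDerivativeOn F D Set.univ
  torsion_free : ∀ {X Y : Π x : N, TangentSpace I x} {x : N}, MDiffAt (T% X) x → MDiffAt (T% Y) x →
    D Y x (X x) - D X x (Y x) = VectorField.mlieBracket I X Y x
  metric : ∀ {X Y Z : Π x : N, TangentSpace I x} {x : N},
    MDiffAt (T% X) x → MDiffAt (T% Y) x → MDiffAt (T% Z) x →
    mvfderiv I (fun y ↦ g y (Y y) (Z y)) x (X x)
      = g x (D Y x (X x)) (Z x) + g x (Y x) (D Z x (X x))

/-- The Levi-Civita connection of `g`. -/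
def leviCivita (g : BilinField I N) :
    (Π x : N, TangentSpace I x) → (Π x : N, TangentSpace I x →L[ℝ] TangentSpace I x) :=
  Classical.epsilon (IsLeviCivita g)

/-- The 2-form `ω = g(J·, ·)`. -/
def fundamentalForm (J : EndField I N) (g : BilinField I N) : BilinField I N :=
  fun x ↦ (g x).comp (J x)

/-- The covariant derivative `(D_u ω)(v, w)` of a field of bilinear forms. -/
def covDerivBilin
    (D : (Π x : N, TangentSpace I x) → (Π x : N, TangentSpace I x →L[ℝ] TangentSpace I x))
    (Om : BilinField I N) (x : N) (u v w : TangentSpace I x) : ℝ :=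
  mvfderiv I (fun y ↦ Om y (extend F v y) (extend F w y)) x u
    - Om x (D (extend F v) x u) w - Om x v (D (extend F w) x u)

/-- The codifferential `d^*ω = -∑ i, (∇^{LC}_{E_i} ω)(E_i, ·)` of a 2-form. -/
def codifferential (g Om : BilinField I N) : OneForm I N :=
  fun x v ↦ -∑ i, covDerivBilin (leviCivita g) Om x
    (orthonormalBasisAt g x i) (orthonormalBasisAt g x i) v

/-- The Lee form `θ = -d^*ω ∘ J` of the Hermitian structure `(J, g)`. -/
def leeForm (J : EndField I N) (g : BilinField I N) : OneForm I N :=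
  fun x v ↦ -codifferential g (fundamentalForm J g) x (J x v)

/-- The exterior derivative of a 1-form:
`dθ(X, Y) = X(θ(Y)) - Y(θ(X)) - θ([X, Y])`. -/
def extDerivOneForm (θ : OneForm I N) (X Y : Π x : N, TangentSpace I x) (x : N) : ℝ :=
  mvfderiv I (fun y ↦ θ y (Y y)) x (X x) - mvfderiv I (fun y ↦ θ y (X y)) x (Y x)
    - θ x (VectorField.mlieBracket I X Y x)

/-- The 1-form `θ` is closed. -/
def IsClosedOneForm (θ : OneForm I N) : Prop :=
  ∀ (x : N) (X Y : Π x : N, TangentSpace I x), MDiffAt (T% X) x → MDiffAt (T% Y) x →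
    extDerivOneForm θ X Y x = 0

/-- The Hermitian structure `(J, g)` is balanced. -/
def IsBalanced (J : EndField I N) (g : BilinField I N) : Prop :=
  ∀ x v, leeForm J g x v = 0

/-- The Hermitian structure `(J, g)` is locally conformally balanced. -/
def IsLocallyConformallyBalanced (J : EndField I N) (g : BilinField I N) : Prop :=
  IsClosedOneForm (leeForm J g)

end Generic

/-! ### Affine-Riemann manifolds -/

section Affine

variable {E : Type*} [NormedAddCommGroup E] [NormedSpace ℝ E]
  {M : Type*} [TopologicalSpace M] [ChartedSpace E M] [IsManifold 𝓘(ℝ, E) ∞ M]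

/-- The connection `∇` is flat: `∇_X ∇_Y Z - ∇_Y ∇_X Z - ∇_{[X, Y]} Z = 0` for all smooth vector
fields. -/
def IsFlat (nabla : CovariantDerivative 𝓘(ℝ, E) E (TangentSpace 𝓘(ℝ, E) : M → Type _)) : Prop :=
  ∀ X Y Z : (Π x : M, TangentSpace 𝓘(ℝ, E) x),
    ContMDiff 𝓘(ℝ, E) 𝓘(ℝ, E).tangent ∞ (T% X) → ContMDiff 𝓘(ℝ, E) 𝓘(ℝ, E).tangent ∞ (T% Y) →
    ContMDiff 𝓘(ℝ, E) 𝓘(ℝ, E).tangent ∞ (T% Z) → ∀ x,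
    nabla (fun y ↦ nabla Z y (Y y)) x (X x) - nabla (fun y ↦ nabla Z y (X y)) x (Y x)
      - nabla Z x (VectorField.mlieBracket 𝓘(ℝ, E) X Y x) = 0

variable (nabla : CovariantDerivative 𝓘(ℝ, E) E (TangentSpace 𝓘(ℝ, E) : M → Type _))
  (g : BilinField 𝓘(ℝ, E) M)

/-- The difference tensor `γ_v w = D_v w - ∇_v w`, where `D` is the Levi-Civita connection. -/
def differenceTensor (x : M) (v w : TangentSpace 𝓘(ℝ, E) x) : TangentSpace 𝓘(ℝ, E) x :=
  leviCivita g (extend E w) x v - nabla (extend E w) x v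

/-- The adjoint `γ^*` of the difference tensor: `⟨γ^*_v w, z⟩ = ⟨w, γ_v z⟩`.  It is written here
through its components `⟨γ^*_v w, e_i⟩ = ⟨w, γ_v e_i⟩` in an orthonormal basis. -/
def adjointDifferenceTensor (x : M) (v w : TangentSpace 𝓘(ℝ, E) x) : TangentSpace 𝓘(ℝ, E) x :=
  ∑ i, g x w (differenceTensor nabla g x v (orthonormalBasisAt g x i)) • orthonormalBasisAt g x i

/-- The trace `∑ i, B(E_i, E_i)` with respect to `g` of a field `B` of vector valued bilinear
maps. -/
def metricTrace
    (B : Π x : M, TangentSpace 𝓘(ℝ, E) x → TangentSpace 𝓘(ℝ, E) x → TangentSpace 𝓘(ℝ, E) x)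
    (x : M) : TangentSpace 𝓘(ℝ, E) x :=
  ∑ i, B x (orthonormalBasisAt g x i) (orthonormalBasisAt g x i)

/-- The first Koszul form `α = ⟨tr γ^*, ·⟩`. -/
def firstKoszulForm : OneForm 𝓘(ℝ, E) M :=
  fun x v ↦ g x (metricTrace g (adjointDifferenceTensor nabla g) x) v

/-- The adjoint Koszul form `ξ = ⟨tr γ, ·⟩`. -/
def adjointKoszulForm : OneForm 𝓘(ℝ, E) M :=
  fun x v ↦ g x (metricTrace g (differenceTensor nabla g) x) v

/-! The Hermitian structure of the tangent bundle.  The tangent space of `TM` at `p = (x, u)` is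
`E × E` through the chart of `TM` at `p` that is induced by the chart of `M` at `x`; the latter also
identifies `T_x M` with `E`, and `extend E u` is the vector field with constant components `u` in
this chart.  So the Christoffel term `∑ b_i u_j Γ_{ij}^l ∂_l` at `x` is `nabla (extend E u) x b`. -/

/-- The differential at `p` of the projection `π : TM → M`. -/
def dproj (p : TangentBundle 𝓘(ℝ, E) M) :
    TangentSpace 𝓘(ℝ, E).tangent p →L[ℝ] TangentSpace 𝓘(ℝ, E) p.1 :=
  mfderiv 𝓘(ℝ, E).tangent 𝓘(ℝ, E) (fun q : TangentBundle 𝓘(ℝ, E) M ↦ q.1) p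

/-- The fibre component of a tangent vector of `TM` in the chart of `TM` at its base point. -/
def fibreComponent (p : TangentBundle 𝓘(ℝ, E) M) :
    TangentSpace 𝓘(ℝ, E).tangent p →L[ℝ] TangentSpace 𝓘(ℝ, E) p.1 :=
  ContinuousLinearMap.snd ℝ E E

/-- The connection map `Q(b, Z) = Z + Γ(b, u)` at `p = (x, u)`. -/
def connectionMap (p : TangentBundle 𝓘(ℝ, E) M) :
    TangentSpace 𝓘(ℝ, E).tangent p →L[ℝ] TangentSpace 𝓘(ℝ, E) p.1 :=
  fibreComponent p + (nabla (extend E p.2) p.1).comp (dproj p)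

/-- The vertical lift `z ↦ (0, z)`. -/
def verticalLift (p : TangentBundle 𝓘(ℝ, E) M) :
    TangentSpace 𝓘(ℝ, E) p.1 →L[ℝ] TangentSpace 𝓘(ℝ, E).tangent p :=
  ContinuousLinearMap.inr ℝ E E

/-- The horizontal lift `b ↦ (b, -Γ(b, u))` at `p = (x, u)`. -/
def horizontalLift (p : TangentBundle 𝓘(ℝ, E) M) :
    TangentSpace 𝓘(ℝ, E) p.1 →L[ℝ] TangentSpace 𝓘(ℝ, E).tangent p :=
  (show TangentSpace 𝓘(ℝ, E) p.1 →L[ℝ] TangentSpace 𝓘(ℝ, E).tangent p from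
    ContinuousLinearMap.inl ℝ E E) - (verticalLift p).comp (nabla (extend E p.2) p.1)

/-- The complex structure `J₁` of `TM`: `J₁ X^h = X^v` and `J₁ X^v = -X^h`. -/
def complexStructure : EndField 𝓘(ℝ, E).tangent (TangentBundle 𝓘(ℝ, E) M) :=
  fun p ↦ (verticalLift p).comp (dproj p) - (horizontalLift nabla p).comp (connectionMap nabla p)

/-- The bilinear form `(v, w) ↦ B(A v, A w)`. -/
def pullbackBilin {V W : Type*} [AddCommGroup V] [Module ℝ V] [TopologicalSpace V]
    [AddCommGroup W] [Module ℝ W] [TopologicalSpace W] (B : W →L[ℝ] W →L[ℝ] ℝ) (A : V →L[ℝ] W) :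
    V →L[ℝ] V →L[ℝ] ℝ :=
  (ContinuousLinearMap.precomp ℝ A).comp (B.comp A)

/-- The metric `g₁` of `TM`: `g₁(X^h, Y^h) = g₁(X^v, Y^v) = ⟨X, Y⟩ ∘ π` and `g₁(X^h, Y^v) = 0`. -/
def tangentMetric : BilinField 𝓘(ℝ, E).tangent (TangentBundle 𝓘(ℝ, E) M) :=
  fun p ↦ pullbackBilin (g p.1) (dproj p) + pullbackBilin (g p.1) (connectionMap nabla p)

end Affine

end AffineRiemann

end

/-!
The Lee form of an almost Hermitian manifold is a trace of `dω`: differentiating `J² = -1` and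
`g(J·, J·) = g` gives `(∇_u ω)(J v, w) = (∇_u ω)(v, J w)`, and with it, for an orthonormal basis
`(h_i, J h_i)`, `θ(w) = ∑ i, dω(h_i, J h_i, w)` (`leeForm_eq_sum`, `cyclic_covDerivBilin`).
On `TM` take for `h_i` the horizontal lifts of an orthonormal basis `e_i`.  Then `dω` is computed from the fields `e_i^h`, `e_i^v` and a lift of `w` by means of
`ω(V, W) = ⟨dπ V, Q W⟩ - ⟨Q V, dπ W⟩`, `Q` being the connection map, and of the brackets
`[X^h, Y^v] = (∇_X Y)^v`, `[X^v, Y^v] = 0` and `dπ [X^h, Y^h] = [X, Y]`.  The result is `0` for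
vertical `w`, and `∑ i, ⟨γ_Z e_i, e_i⟩ - ⟨γ_{e_i} e_i, Z⟩ = (α - ξ)(Z)` for `w = Z^h`
(`leeForm_tangentMetric`).  The characterizations of balanced structures follow, as `dπ` is
surjective and the metric is nondegenerate.

A pullback by the submersion `π` is closed if and only if the form itself is
(`isClosedOneForm_pullbackProj`), so the last part amounts to `dα = 0`
(`isClosedOneForm_firstKoszulForm`).  In a local orthonormal frame `f_i` the Levi-Civita connection
matrix is skew, hence `α` is minus the trace of the connection matrix of `∇`, and `dα` is minus the
trace of the curvature of `∇`, which is zero.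

Brackets and covariant derivatives at a point are computed with the derivative of components in
the chart at that point: it is a torsion free connection for which the fields with constant
components are parallel at the point (`covariantDerivative_eq_chartDeriv_add`,
`mlieBracket_eq_chartDeriv`).  Since `leviCivita` is a choice, the existence of the Levi-Civita
connection has to be proved, for the metric of `M` as well as for that of `TM`
(`exists_isLeviCivita`); only differentiability of the metric is needed.
-/


noncomputable section

namespace AffineRiemann

open scoped Topology

/-! ### Componentwise derivatives in charts -/

section ChartDerivative

variable {F : Type*} [NormedAddCommGroup F] [NormedSpace ℝ F]
  {H : Type*} [TopologicalSpace H] {I : ModelWithCorners ℝ F H}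
  {N : Type*} [TopologicalSpace N] [ChartedSpace H N]

lemma mvfderiv_congr {G : Type*} [NormedAddCommGroup G] [NormedSpace ℝ G] {f f' : N → G} {x : N}
    (h : f =ᶠ[𝓝 x] f') : mvfderiv I f x = mvfderiv I f' x := by
  unfold mvfderiv
  rw [h.mfderiv_eq]
  ext v
  rfl

/-- A linear map applied to a differentiable function commutes with the differential. -/
lemma mvfderiv_clm_comp {G G' : Type*} [NormedAddCommGroup G] [NormedSpace ℝ G]
    [NormedAddCommGroup G'] [NormedSpace ℝ G'] {f : N → G} {x : N} (L : G →L[ℝ] G')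
    (hf : MDiffAt f x) (v : TangentSpace I x) :
    mvfderiv I (fun y ↦ L (f y)) x v = L (mvfderiv I f x v) := by
  have h1 : HasMFDerivAt 𝓘(ℝ, G) 𝓘(ℝ, G') L (f x) L := L.hasMFDerivAt
  have := (h1.comp x hf.hasMFDerivAt).mfderiv
  unfold mvfderiv
  change NormedSpace.fromTangentSpace (L (f x)) (mfderiv I 𝓘(ℝ, G') (L ∘ f) x v) = _
  rw [this]
  rfl

lemma mdifferentiableAt_fun_sum {G ι : Type*} [NormedAddCommGroup G] [NormedSpace ℝ G]
    {f : ι → N → G} {x : N} (s : Finset ι) (h : ∀ i ∈ s, MDiffAt (f i) x) :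
    MDiffAt (fun y ↦ ∑ i ∈ s, f i y) x ∧
      mvfderiv I (fun y ↦ ∑ i ∈ s, f i y) x = ∑ i ∈ s, mvfderiv I (f i) x := by
  classical
  induction s using Finset.induction_on with
  | empty =>
    simp only [Finset.sum_empty]
    exact ⟨mdifferentiableAt_const, mvfderiv_const 0⟩
  | insert a s ha ih =>
    have h1 := ih fun i hi ↦ h i (Finset.mem_insert_of_mem hi)
    have h2 := h a (Finset.mem_insert_self a s)
    simp only [Finset.sum_insert ha]
    exact ⟨h2.add h1.1, by rw [mvfderiv_fun_add h2 h1.1, h1.2]⟩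

variable (I) in
/-- The identification of the model space with the tangent space at `x`, through the chart
at `x`. -/
def modelEquiv (x : N) : F ≃L[ℝ] TangentSpace I x := ContinuousLinearEquiv.refl ℝ F

variable [IsManifold I 1 N]

variable (I) in
/-- The coordinates of tangent vectors at `y` in the chart at `x`. -/
def tangentCoord (x y : N) : TangentSpace I y →L[ℝ] F :=
  (show F →L[ℝ] F from tangentCoordChange I y x y)

lemma tangentCoord_eq_trivializationAt (x y : N) (v : TangentSpace I y) :
    tangentCoord I x y v = (trivializationAt F (TangentSpace I) x ⟨y, v⟩).2 := rfl

lemma tangentCoord_eq_mfderiv {x y : N} (hy : y ∈ (chartAt H x).source) (v : TangentSpace I y) :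
    tangentCoord I x y v = mfderiv I 𝓘(ℝ, F) (extChartAt I x) y v := by
  have h := DFunLike.congr_fun (TangentBundle.continuousLinearMapAt_trivializationAt (I := I) hy) v
  refine Eq.trans ?_ h
  rw [Trivialization.continuousLinearMapAt_apply, Trivialization.linearMapAt_apply, if_pos]
  · rfl
  · exact hy

@[simp] lemma tangentCoord_self (x : N) (v : TangentSpace I x) :
    tangentCoord I x x v = (modelEquiv I x).symm v :=
  (tangentBundleCore I N).coordChange_self (achart H x) x (mem_achart_source H x) v

lemma tangentCoord_extend {x y : N} (hy : y ∈ (chartAt H x).source) (v : TangentSpace I x) :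
    tangentCoord I x y (extend F v y) = (modelEquiv I x).symm v := by
  have h := (trivializationAt F (TangentSpace I) x).apply_mk_symm (b := y) hy
    (trivializationAt F (TangentSpace I) x ⟨x, v⟩).2
  simp only [tangentCoord_eq_trivializationAt, extend]
  rw [h]
  exact tangentCoord_self x v

lemma extend_tangentCoord {x y : N} (hy : y ∈ (chartAt H x).source) (v : TangentSpace I y) :
    extend F (modelEquiv I x (tangentCoord I x y v)) y = v := by
  have e : (trivializationAt F (TangentSpace I) x
      ⟨x, modelEquiv I x (tangentCoord I x y v)⟩).2 = tangentCoord I x y v := by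
    rw [← tangentCoord_eq_trivializationAt, tangentCoord_self]
    simp
  simp only [extend]
  rw [e]
  exact (trivializationAt F (TangentSpace I) x).symm_apply_apply_mk hy v

lemma tangentCoord_injective {x y : N} (hy : y ∈ (chartAt H x).source) :
    Function.Injective (tangentCoord I x y) := fun v w h ↦ by
  rw [← extend_tangentCoord hy v, h, extend_tangentCoord hy w]

lemma mdifferentiableAt_tangentCoord {V : Π x : N, TangentSpace I x} {x : N} :
    MDiffAt (T% V) x ↔ MDiffAt (fun y ↦ tangentCoord I x y (V y)) x :=
  mdifferentiableAt_section I V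

omit [IsManifold I 1 N] in
lemma eventually_mem_chart_source (x : N) : ∀ᶠ y in 𝓝 x, y ∈ (chartAt H x).source :=
  (chartAt H x).open_source.mem_nhds (mem_chart_source H x)

/-- The componentwise derivative of a vector field in the chart at the base point. -/
def chartDeriv (V : Π x : N, TangentSpace I x) (x : N) :
    TangentSpace I x →L[ℝ] TangentSpace I x :=
  (modelEquiv I x).toContinuousLinearMap.comp (mvfderiv I (fun y ↦ tangentCoord I x y (V y)) x)

lemma chartDeriv_apply (V : Π x : N, TangentSpace I x) (x : N) (v : TangentSpace I x) :
    chartDeriv V x v = modelEquiv I x (mvfderiv I (fun y ↦ tangentCoord I x y (V y)) x v) := rfl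

@[simp] lemma chartDeriv_extend {x : N} (v : TangentSpace I x) :
    chartDeriv (extend F v) x = 0 := by
  unfold chartDeriv
  rw [mvfderiv_congr (f' := fun _ ↦ (modelEquiv I x).symm v)
    ((eventually_mem_chart_source x).mono fun _ hy ↦ tangentCoord_extend hy v), mvfderiv_const]
  simp

lemma isCovariantDerivativeOn_chartDeriv :
    IsCovariantDerivativeOn F (chartDeriv (I := I) (N := N)) Set.univ where
  add {σ σ' x} hσ hσ' _ := by
    have := mvfderiv_add (mdifferentiableAt_tangentCoord.1 hσ)
      (mdifferentiableAt_tangentCoord.1 hσ')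
    ext v
    simp only [chartDeriv_apply, add_apply, ← map_add]
    rw [← add_apply, ← this]
    congr 3
    ext y
    simp
  leibniz {σ f x} hσ hf _ := by
    have := mvfderiv_smul hf (mdifferentiableAt_tangentCoord.1 hσ)
    rw [tangentCoord_self] at this
    ext v
    have h2 : (fun y ↦ tangentCoord I x y ((f • σ) y))
        = f • fun y ↦ tangentCoord I x y (σ y) := by
      ext y
      simp
    simp only [chartDeriv_apply, h2, this]
    simp [chartDeriv_apply]

variable [FiniteDimensional ℝ F] [IsManifold I 2 N]

/-- A covariant derivative is the componentwise derivative in a chart plus a zero order term. -/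
lemma covariantDerivative_eq_chartDeriv_add
    {D : (Π x : N, TangentSpace I x) → (Π x : N, TangentSpace I x →L[ℝ] TangentSpace I x)}
    (hD : IsCovariantDerivativeOn F D Set.univ) {V : Π x : N, TangentSpace I x} {x : N}
    (hV : MDiffAt (T% V) x) :
    D V x = chartDeriv V x + D (extend F (V x)) x := by
  have hT : TensorialAt I F (fun W ↦ D W x - chartDeriv W x) x :=
    { smul := fun {f σ} hf hσ ↦ by
        rw [hD.leibniz hσ hf, isCovariantDerivativeOn_chartDeriv.leibniz hσ hf]
        module
      add := fun {σ σ'} hσ hσ' ↦ by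
        rw [hD.add hσ hσ', isCovariantDerivativeOn_chartDeriv.add hσ hσ']
        module }
  have h := hT.pointwise hV (mdifferentiableAt_extend I F (V x)) (by simp)
  simp only [chartDeriv_extend, sub_zero] at h
  rw [← h]
  module

/-- The Lie bracket through componentwise derivatives in the chart at the base point: the
componentwise derivative is torsion free, since fields with constant components commute. -/
lemma mlieBracket_eq_chartDeriv {V W : Π x : N, TangentSpace I x} {x : N}
    (hV : MDiffAt (T% V) x) (hW : MDiffAt (T% W) x) :
    VectorField.mlieBracket I V W x = chartDeriv W x (V x) - chartDeriv V x (W x) := by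
  have h := IsCovariantDerivativeOn.torsion_apply
    (isCovariantDerivativeOn_chartDeriv (I := I) (N := N)) hV hW
  rw [IsCovariantDerivativeOn.torsion_apply_eq_extend] at h
  simp only [chartDeriv_extend, zero_apply, sub_zero, zero_sub] at h
  have h0 : VectorField.mlieBracket I (extend F (V x)) (extend F (W x)) x = 0 := by
    have key (v : TangentSpace I x) : VectorField.mpullbackWithin 𝓘(ℝ, F) I (extChartAt I x).symm
        (extend F v) (Set.range I) =ᶠ[𝓝[Set.range I] (extChartAt I x x)]
          fun _ ↦ (modelEquiv I x).symm v := by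
      filter_upwards [extChartAt_target_mem_nhdsWithin x] with a ha
      have hs : (extChartAt I x).symm a ∈ (chartAt H x).source := by
        rw [← extChartAt_source I]
        exact (extChartAt I x).map_target ha
      have h1 := DFunLike.congr_fun (mfderivWithin_extChartAt_symm_comp_mfderiv_extChartAt
        (I := I) ha) (extend F v ((extChartAt I x).symm a))
      have h2 := (tangentCoord_eq_mfderiv hs (extend F v ((extChartAt I x).symm a))).symm.trans
        (tangentCoord_extend hs v)
      have h3 : mfderivWithin 𝓘(ℝ, F) I (extChartAt I x).symm (Set.range I) a
          ((modelEquiv I x).symm v) = extend F v ((extChartAt I x).symm a) :=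
        (congrArg _ h2.symm).trans h1
      exact (isInvertible_mfderivWithin_extChartAt_symm (I := I) ha).inverse_apply_eq.2 h3.symm
    have h4 : VectorField.lieBracketWithin ℝ
        (VectorField.mpullbackWithin 𝓘(ℝ, F) I (extChartAt I x).symm
          (extend F (V x)) (Set.range I))
        (VectorField.mpullbackWithin 𝓘(ℝ, F) I (extChartAt I x).symm
          (extend F (W x)) (Set.range I))
        (Set.range I) (extChartAt I x x) = 0 := by
      have hm : extChartAt I x x ∈ Set.range I := Set.mem_range_self _
      refine ((key (V x)).lieBracketWithin_vectorField_eq_of_mem (key (W x)) hm).trans ?_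
      simp [VectorField.lieBracketWithin]
    rw [VectorField.mlieBracket, VectorField.mlieBracketWithin_apply]
    simp only [Set.preimage_univ, Set.univ_inter]
    exact (congrArg _ h4).trans (map_zero _)
  rw [h0] at h
  rw [eq_comm, ← sub_eq_zero, ← h, neg_zero]

end ChartDerivative

/-! ### Orthonormal bases and traces -/

section LinearAlgebra

variable {V : Type*} [AddCommGroup V] [Module ℝ V] [TopologicalSpace V]
  {ι κ : Type*} [Fintype ι] [Fintype κ] [DecidableEq κ]

lemma linearIndependent_of_orthonormal {B : V →L[ℝ] V →L[ℝ] ℝ} [DecidableEq ι] {e : ι → V}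
    (he : ∀ i j, B (e i) (e j) = if i = j then 1 else 0) : LinearIndependent ℝ e := by
  rw [Fintype.linearIndependent_iff]
  intro c hc j
  have h := congrArg (fun v ↦ B v (e j)) hc
  simpa [he] using h

lemma sum_orthonormal_smul [FiniteDimensional ℝ V] {B : V →L[ℝ] V →L[ℝ] ℝ} [DecidableEq ι]
    {e : ι → V}
    (he : ∀ i j, B (e i) (e j) = if i = j then 1 else 0)
    (hc : Fintype.card ι = Module.finrank ℝ V) (v : V) : ∑ i, B v (e i) • e i = v := by
  rcases isEmpty_or_nonempty ι with hι | hι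
  · have : Subsingleton V := Module.finrank_zero_iff.1 (by rw [← hc]; simp)
    exact Subsingleton.elim _ _
  let b := basisOfLinearIndependentOfCardEqFinrank (linearIndependent_of_orthonormal he) hc
  have hb : ∀ i, b i = e i := fun i ↦ by simp [b]
  obtain ⟨c, rfl⟩ : ∃ c : ι → ℝ, v = ∑ i, c i • e i :=
    ⟨fun i ↦ b.repr v i, by simpa [hb] using (b.sum_repr v).symm⟩
  refine Finset.sum_congr rfl fun j _ ↦ ?_
  simp [he]

lemma exists_orthonormal [FiniteDimensional ℝ V] (B : V →L[ℝ] V →L[ℝ] ℝ)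
    (hs : ∀ v w, B v w = B w v) (hp : ∀ v, v ≠ 0 → 0 < B v v) {n : ℕ}
    (hn : Module.finrank ℝ V = n) :
    ∃ e : Fin n → V, ∀ i j, B (e i) (e j) = if i = j then 1 else 0 := by
  subst hn
  let B' : LinearMap.BilinForm ℝ V := LinearMap.mk₂ ℝ (fun v w ↦ B v w) (by simp) (by simp)
    (by simp) (by simp)
  have hB : LinearMap.IsSymm B' := ⟨fun v w ↦ by simpa [B'] using hs v w⟩
  obtain ⟨b, hb⟩ := LinearMap.BilinForm.exists_orthogonal_basis hB
  have hpos : ∀ i, 0 < B (b i) (b i) := fun i ↦ hp _ (b.ne_zero i)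
  refine ⟨fun i ↦ (Real.sqrt (B (b i) (b i)))⁻¹ • b i, fun i j ↦ ?_⟩
  split_ifs with h
  · subst h
    have h1 := Real.mul_self_sqrt (hpos i).le
    have h2 := (Real.sqrt_pos.2 (hpos i)).ne'
    have h3 (c : ℝ) (v : V) : B (c • v) (c • v) = c * (c * B v v) := by simp
    rw [h3]
    field_simp
    nlinarith
  · have h0 : B (b i) (b j) = 0 := by simpa [B'] using! hb h
    simp [h0]

/-- The trace of a bilinear map does not depend on the orthonormal basis.  Orthonormality of `e` is
expressed by the expansion `hee` alone, so that `e` may be indexed by a sum type. -/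
lemma trace_eq_of_orthonormal {W : Type*} [AddCommGroup W] [Module ℝ W]
    {B : V →L[ℝ] V →L[ℝ] ℝ} (hs : ∀ v w, B v w = B w v) {e : ι → V} {f : κ → V}
    (hf : ∀ i j, B (f i) (f j) = if i = j then 1 else 0)
    (hee : ∀ v, ∑ i, B v (e i) • e i = v) (hff : ∀ v, ∑ i, B v (f i) • f i = v)
    (T : V → V → W) (hadd : ∀ u v w, T (u + v) w = T u w + T v w)
    (hadd' : ∀ u v w, T u (v + w) = T u v + T u w)
    (hsmul : ∀ (c : ℝ) u v, T (c • u) v = c • T u v)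
    (hsmul' : ∀ (c : ℝ) u v, T u (c • v) = c • T u v) :
    ∑ i, T (e i) (e i) = ∑ i, T (f i) (f i) := by
  let L : V →ₗ[ℝ] V →ₗ[ℝ] W := LinearMap.mk₂ ℝ T hadd hsmul hadd' hsmul'
  have hL : ∀ u v, L u v = T u v := fun u v ↦ rfl
  have h1 : ∀ i, T (e i) (e i) =
      ∑ a, ∑ b, (B (e i) (f a) * B (e i) (f b)) • T (f a) (f b) := fun i ↦ by
    conv_lhs => rw [← hL, ← hff (e i)]
    simp only [map_sum, map_smul, LinearMap.sum_apply, LinearMap.smul_apply, hL, Finset.smul_sum,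
      smul_smul]
    rw [Finset.sum_comm]
    simp only [mul_comm]
  have h2 : ∀ a b, ∑ i, B (e i) (f a) * B (e i) (f b) = if a = b then 1 else 0 := fun a b ↦ by
    rw [← hf a b]
    conv_rhs => rw [← hee (f a)]
    simp [hs]
  simp only [h1]
  rw [Finset.sum_comm]
  refine Finset.sum_congr rfl fun a _ ↦ ?_
  rw [Finset.sum_comm]
  simp only [← Finset.sum_smul, h2]
  simp

end LinearAlgebra

/-! ### Covariant derivatives of bilinear forms -/

section Tensor

variable {F : Type*} [NormedAddCommGroup F] [NormedSpace ℝ F]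
  {H : Type*} [TopologicalSpace H] {I : ModelWithCorners ℝ F H}
  {N : Type*} [TopologicalSpace N] [ChartedSpace H N]

instance [FiniteDimensional ℝ F] (x : N) : FiniteDimensional ℝ (TangentSpace I x) :=
  inferInstanceAs (FiniteDimensional ℝ F)

lemma finrank_tangentSpace (x : N) :
    Module.finrank ℝ (TangentSpace I x) = Module.finrank ℝ F := rfl

instance (x : N) : T2Space (TangentSpace I x) := inferInstanceAs (T2Space F)

/-- A field of bilinear forms is differentiable at `x` if it takes differentiable vector fields to
differentiable functions. -/
def IsDifferentiableBilinAt [IsManifold I 1 N] (Om : BilinField I N) (x : N) : Prop :=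
  ∀ {V W : Π x : N, TangentSpace I x}, MDiffAt (T% V) x → MDiffAt (T% W) x →
    MDiffAt (fun y ↦ Om y (V y) (W y)) x

variable [IsManifold I 2 N]
  {D : (Π x : N, TangentSpace I x) → (Π x : N, TangentSpace I x →L[ℝ] TangentSpace I x)}

/-- The expression `u(Ω(V, W)) - Ω(D_u V, W) - Ω(V, D_u W)` that computes `(D_u Ω)(V, W)`. -/
def covDerivBilinAux
    (D : (Π x : N, TangentSpace I x) → (Π x : N, TangentSpace I x →L[ℝ] TangentSpace I x))
    (Om : BilinField I N) (x : N) (u : TangentSpace I x) (V W : Π x : N, TangentSpace I x) : ℝ :=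
  mvfderiv I (fun y ↦ Om y (V y) (W y)) x u - Om x (D V x u) (W x) - Om x (V x) (D W x u)

variable (hD : IsCovariantDerivativeOn F D Set.univ) {Om : BilinField I N} {x : N}
  (hOm : IsDifferentiableBilinAt Om x)
include hD hOm

lemma tensorialAt_covDerivBilinAux_left (u : TangentSpace I x) (W : Π x : N, TangentSpace I x)
    (hW : MDiffAt (T% W) x) : TensorialAt I F (covDerivBilinAux D Om x u · W) x where
  smul {f σ} hf hσ := by
    have h := mvfderiv_fun_mul (I := I) hf (hOm hσ hW)
    simp [covDerivBilinAux, hD.leibniz hσ hf, h]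
    ring
  add {σ σ'} hσ hσ' := by
    have h := mvfderiv_fun_add (I := I) (hOm hσ hW) (hOm hσ' hW)
    simp [covDerivBilinAux, hD.add hσ hσ', h]
    ring

lemma tensorialAt_covDerivBilinAux_right (u : TangentSpace I x) (V : Π x : N, TangentSpace I x)
    (hV : MDiffAt (T% V) x) : TensorialAt I F (covDerivBilinAux D Om x u V) x where
  smul {f σ} hf hσ := by
    have h := mvfderiv_fun_mul (I := I) hf (hOm hV hσ)
    simp [covDerivBilinAux, hD.leibniz hσ hf, h]
    ring
  add {σ σ'} hσ hσ' := by
    have h := mvfderiv_fun_add (I := I) (hOm hV hσ) (hOm hV hσ')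
    simp [covDerivBilinAux, hD.add hσ hσ', h]
    ring

variable [FiniteDimensional ℝ F]

/-- The covariant derivative of a field of bilinear forms may be computed with any differentiable
extensions of its arguments. -/
lemma covDerivBilin_eq (u : TangentSpace I x) {V W : Π x : N, TangentSpace I x}
    (hV : MDiffAt (T% V) x) (hW : MDiffAt (T% W) x) :
    covDerivBilin D Om x u (V x) (W x) = covDerivBilinAux D Om x u V W := by
  have h := TensorialAt.pointwise₂ (tensorialAt_covDerivBilinAux_left hD hOm u)
    (tensorialAt_covDerivBilinAux_right hD hOm u)
    (mdifferentiableAt_extend I F (V x)) hV (mdifferentiableAt_extend I F (W x)) hW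
    (by simp) (by simp)
  rw [← h]
  simp [covDerivBilin, covDerivBilinAux]

/-- The covariant derivative of a field of bilinear forms, as a bilinear form. -/
lemma exists_covDerivBilin_eq (u : TangentSpace I x) :
    ∃ T : TangentSpace I x →L[ℝ] TangentSpace I x →L[ℝ] ℝ,
      ∀ v w, covDerivBilin D Om x u v w = T v w := by
  refine ⟨TensorialAt.mkHom₂ _ x (tensorialAt_covDerivBilinAux_left hD hOm u)
    (tensorialAt_covDerivBilinAux_right hD hOm u), fun v w ↦ ?_⟩
  rw [TensorialAt.mkHom₂_apply_eq_extend]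
  simp [covDerivBilin, covDerivBilinAux]

end Tensor

/-! ### Existence of the Levi-Civita connection -/

section LeviCivita

variable {F : Type*} [NormedAddCommGroup F] [NormedSpace ℝ F] [FiniteDimensional ℝ F]
  {H : Type*} [TopologicalSpace H] {I : ModelWithCorners ℝ F H}
  {N : Type*} [TopologicalSpace N] [ChartedSpace H N] {g : BilinField I N}

lemma isOrthonormalAt_orthonormalBasisAt {x : N} (hs : ∀ v w, g x v w = g x w v)
    (hp : ∀ v, v ≠ 0 → 0 < g x v v) : IsOrthonormalAt g x (orthonormalBasisAt g x) :=
  Classical.epsilon_spec (exists_orthonormal (g x) hs hp (finrank_tangentSpace x))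

lemma sum_isOrthonormalAt {x : N} {e : Fin (Module.finrank ℝ F) → TangentSpace I x}
    (he : IsOrthonormalAt g x e) (v : TangentSpace I x) : ∑ i, g x v (e i) • e i = v :=
  sum_orthonormal_smul he (by simp [finrank_tangentSpace]) v

variable [IsManifold I 2 N]

/-- The pointwise Koszul formula: a symmetric bilinear map with prescribed metric symmetrization. -/
lemma exists_christoffel {x : N} (hs : ∀ y v w, g y v w = g y w v)
    (hp : ∀ v, v ≠ 0 → 0 < g x v v) (hd : IsDifferentiableBilinAt g x) :
    ∃ A : TangentSpace I x →L[ℝ] TangentSpace I x →L[ℝ] TangentSpace I x,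
      (∀ u v, A u v = A v u) ∧ ∀ u v w,
        g x (A v u) w + g x v (A w u) = covDerivBilin chartDeriv g x u v w := by
  obtain ⟨e, he⟩ := exists_orthonormal (g x) (hs x) hp (finrank_tangentSpace x)
  choose T hT using exists_covDerivBilin_eq isCovariantDerivativeOn_chartDeriv hd
  have hadd (u u' v w) : T (u + u') v w = T u v w + T u' v w := by
    simp only [← hT, covDerivBilin, map_add, add_apply]
    ring
  have hsmul (c : ℝ) (u v w) : T (c • u) v w = c * T u v w := by
    simp only [← hT, covDerivBilin, map_smul, smul_apply, smul_eq_mul]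
    ring
  have hsymm (u v w) : T u v w = T u w v := by
    simp only [← hT, covDerivBilin]
    rw [show (fun y ↦ g y (extend F v y) (extend F w y))
      = fun y ↦ g y (extend F w y) (extend F v y) from funext fun y ↦ hs y _ _,
      hs x _ w, hs x v]
    ring
  let A : TangentSpace I x →ₗ[ℝ] TangentSpace I x →ₗ[ℝ] TangentSpace I x :=
    LinearMap.mk₂ ℝ (fun v u ↦ ∑ i, ((1 / 2 : ℝ) * (T u v (e i) + T v u (e i) - T (e i) u v)) • e i)
      (fun v v' u ↦ by
        simp only [hadd, map_add, add_apply, ← Finset.sum_add_distrib, ← add_smul]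
        refine Finset.sum_congr rfl fun i _ ↦ congrArg (· • e i) (by ring))
      (fun c v u ↦ by
        simp only [hsmul, map_smul, smul_apply, smul_eq_mul, Finset.smul_sum, smul_smul]
        refine Finset.sum_congr rfl fun i _ ↦ congrArg (· • e i) (by ring))
      (fun v u u' ↦ by
        simp only [hadd, map_add, add_apply, ← Finset.sum_add_distrib, ← add_smul]
        refine Finset.sum_congr rfl fun i _ ↦ congrArg (· • e i) (by ring))
      (fun c v u ↦ by
        simp only [hsmul, map_smul, smul_apply, smul_eq_mul, Finset.smul_sum, smul_smul]
        refine Finset.sum_congr rfl fun i _ ↦ congrArg (· • e i) (by ring))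
  have hA (v u w) : g x (A v u) w = (1 / 2 : ℝ) * (T u v w + T v u w - T w u v) := by
    have hL : ∃ L : TangentSpace I x →ₗ[ℝ] ℝ,
        ∀ w, L w = (1 / 2 : ℝ) * (T u v w + T v u w - T w u v) :=
      ⟨{ toFun := fun w ↦ (1 / 2 : ℝ) * (T u v w + T v u w - T w u v)
         map_add' := fun w w' ↦ by simp only [map_add, hadd]; ring
         map_smul' := fun c w ↦ by
          simp only [map_smul, hsmul, smul_eq_mul, RingHom.id_apply]; ring }, fun _ ↦ rfl⟩
    obtain ⟨L, hL⟩ := hL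
    rw [← hL]
    conv_rhs => rw [← sum_isOrthonormalAt he w]
    simp only [A, LinearMap.mk₂_apply, ← hL, map_sum, map_smul, sum_apply,
      smul_apply, smul_eq_mul]
    exact Finset.sum_congr rfl fun i _ ↦ by rw [hs x w]; ring
  refine ⟨A.toContinuousBilinearMap, fun u v ↦ ?_, fun u v w ↦ ?_⟩
  · change A u v = A v u
    simp only [A, LinearMap.mk₂_apply]
    refine Finset.sum_congr rfl fun i _ ↦ congrArg (· • e i) ?_
    rw [hsymm (e i) v u]
    ring
  · change g x (A v u) w + g x v (A w u) = _
    rw [hT, hs x v, hA, hA, hsymm u w v, hsymm w u v, hsymm w v u]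
    ring

/-- The fundamental theorem of Riemannian geometry, existence part.  No smoothness of the
connection is asked for, so that it may be built point by point, at `x` from the
componentwise derivative in the chart at `x`. -/
theorem exists_isLeviCivita (hs : ∀ x v w, g x v w = g x w v)
    (hp : ∀ x v, v ≠ 0 → 0 < g x v v) (hd : ∀ x, IsDifferentiableBilinAt g x) :
    ∃ D, IsLeviCivita g D := by
  choose A hA hA' using fun x ↦ exists_christoffel hs (hp x) (hd x)
  refine ⟨fun V x ↦ chartDeriv V x + A x (V x),
    isCovariantDerivativeOn_chartDeriv.add_one_form A, ?_, ?_⟩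
  · intro X Y x hX hY
    rw [mlieBracket_eq_chartDeriv hX hY]
    simp only [add_apply, hA x (X x)]
    abel
  · intro X Y Z x hX hY hZ
    have h := covDerivBilin_eq isCovariantDerivativeOn_chartDeriv (hd x) (X x) hY hZ
    rw [← hA', covDerivBilinAux] at h
    simp only [add_apply, map_add]
    linarith

theorem isLeviCivita_leviCivita (hs : ∀ x v w, g x v w = g x w v)
    (hp : ∀ x v, v ≠ 0 → 0 < g x v v) (hd : ∀ x, IsDifferentiableBilinAt g x) :
    IsLeviCivita g (leviCivita g) :=
  Classical.epsilon_spec (exists_isLeviCivita hs hp hd)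

end LeviCivita

/-! ### The Lee form of an almost Hermitian manifold -/

section Hermitian

variable {F : Type*} [NormedAddCommGroup F] [NormedSpace ℝ F] [FiniteDimensional ℝ F]
  {H : Type*} [TopologicalSpace H] {I : ModelWithCorners ℝ F H}
  {N : Type*} [TopologicalSpace N] [ChartedSpace H N] [IsManifold I 2 N]
  {J : EndField I N} {g : BilinField I N}
  {D : (Π x : N, TangentSpace I x) → (Π x : N, TangentSpace I x →L[ℝ] TangentSpace I x)}

omit [FiniteDimensional ℝ F] [IsManifold I 2 N] in
@[simp] lemma fundamentalForm_apply (x : N) (v w : TangentSpace I x) :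
    fundamentalForm J g x v w = g x (J x v) w := rfl

/-- The exterior derivative of a 2-form on three vector fields. -/
def extDerivTwoForm (Om : BilinField I N) (U V W : Π x : N, TangentSpace I x) (x : N) : ℝ :=
  mvfderiv I (fun y ↦ Om y (V y) (W y)) x (U x) + mvfderiv I (fun y ↦ Om y (W y) (U y)) x (V x)
    + mvfderiv I (fun y ↦ Om y (U y) (V y)) x (W x)
    - Om x (VectorField.mlieBracket I U V x) (W x) - Om x (VectorField.mlieBracket I V W x) (U x)
    - Om x (VectorField.mlieBracket I W U x) (V x)

omit [FiniteDimensional ℝ F] in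
lemma covDerivBilin_swap {Om : BilinField I N} (hOm : ∀ x v w, Om x v w = -Om x w v) (x : N)
    (u v w : TangentSpace I x) : covDerivBilin D Om x u v w = -covDerivBilin D Om x u w v := by
  simp only [covDerivBilin]
  rw [show (fun y ↦ Om y (extend F v y) (extend F w y))
    = fun y ↦ -Om y (extend F w y) (extend F v y) from funext fun y ↦ hOm y _ _,
    hOm x _ w, hOm x v, mvfderiv_fun_neg]
  simp only [neg_apply]
  ring

/-- The exterior derivative of a 2-form is the alternation of its covariant derivative, for a
torsion free connection. -/
lemma cyclic_covDerivBilin (hD : IsLeviCivita g D) {Om : BilinField I N}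
    (hOm : ∀ x v w, Om x v w = -Om x w v) {x : N} (hd : IsDifferentiableBilinAt Om x)
    {U V W : Π x : N, TangentSpace I x} (hU : MDiffAt (T% U) x) (hV : MDiffAt (T% V) x)
    (hW : MDiffAt (T% W) x) :
    covDerivBilin D Om x (U x) (V x) (W x) + covDerivBilin D Om x (V x) (W x) (U x)
      + covDerivBilin D Om x (W x) (U x) (V x) = extDerivTwoForm Om U V W x := by
  have hD' := hD.isCovariantDerivative
  rw [covDerivBilin_eq hD' hd _ hV hW, covDerivBilin_eq hD' hd _ hW hU,
    covDerivBilin_eq hD' hd _ hU hV]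
  simp only [covDerivBilinAux, extDerivTwoForm, ← hD.torsion_free hU hV, ← hD.torsion_free hV hW,
    ← hD.torsion_free hW hU, map_sub, sub_apply]
  rw [hOm x (V x) (D W x (U x)), hOm x (W x) (D U x (V x)), hOm x (U x) (D V x (W x))]
  ring

variable (hD : IsLeviCivita g D) (hs : ∀ x v w, g x v w = g x w v)
  (hJ : ∀ x v, J x (J x v) = -v) (hJg : ∀ x v w, g x (J x v) (J x w) = g x v w)

include hs hJ hJg in
omit [FiniteDimensional ℝ F] [IsManifold I 2 N] in
lemma fundamentalForm_swap (x : N) (v w : TangentSpace I x) :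
    fundamentalForm J g x v w = -fundamentalForm J g x w v := by
  simp only [fundamentalForm_apply]
  rw [← hJg x (J x v) w, hJ, map_neg, neg_apply, hs x v]

variable {x : N} (hd : IsDifferentiableBilinAt (fundamentalForm J g) x)
  (hext : ∀ v : TangentSpace I x, ∃ V : Π x : N, TangentSpace I x,
    MDiffAt (T% V) x ∧ MDiffAt (T% (fun y ↦ J y (V y))) x ∧ V x = v)

include hD hJ hJg hd hext in
/-- The covariant derivative of the fundamental form is compatible with the almost complex
structure, since `D_u J` anticommutes with `J`. -/
lemma covDerivBilin_fundamentalForm_comm (u v w : TangentSpace I x) :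
    covDerivBilin D (fundamentalForm J g) x u (J x v) w
      = covDerivBilin D (fundamentalForm J g) x u v (J x w) := by
  obtain ⟨V, hV, hJV, rfl⟩ := hext v
  obtain ⟨W, hW, hJW, rfl⟩ := hext w
  have hD' := hD.isCovariantDerivative
  have hu : MDiffAt (T% (extend F u : Π x : N, TangentSpace I x)) x :=
    mdifferentiableAt_extend I F u
  rw [covDerivBilin_eq hD' hd u hJV hW, covDerivBilin_eq hD' hd u hV hJW]
  have h1 := hD.metric hu hV hW
  have h2 := hD.metric hu hJV hJW
  simp only [hJg, extend_apply_self] at h1 h2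
  simp only [covDerivBilinAux, fundamentalForm_apply, hJ, hJg, map_neg, neg_apply]
  rw [mvfderiv_fun_neg, neg_apply]
  have h3 := hJg x (J x (D (fun y ↦ J y (V y)) x u)) (W x)
  rw [hJ, map_neg, neg_apply] at h3
  linarith

include hs hJ hJg hd hext in
/-- The Lee form as a trace of the exterior derivative of the fundamental form, here written as an
alternation of its covariant derivative, along a half basis `h` such that `(h, J h)` is an
orthonormal basis. -/
lemma leeForm_eq_sum (hp : ∀ x v, v ≠ 0 → 0 < g x v v) (hD : IsLeviCivita g (leviCivita g))
    {κ : Type*} [Fintype κ] (h : κ → TangentSpace I x)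
    (hh : ∀ v, ∑ i, g x v (h i) • h i + ∑ i, g x v (J x (h i)) • J x (h i) = v)
    (w : TangentSpace I x) :
    leeForm J g x w = ∑ i,
      (covDerivBilin (leviCivita g) (fundamentalForm J g) x (h i) (J x (h i)) w
      + covDerivBilin (leviCivita g) (fundamentalForm J g) x (J x (h i)) w (h i)
      + covDerivBilin (leviCivita g) (fundamentalForm J g) x w (h i) (J x (h i))) := by
  set T := covDerivBilin (leviCivita g) (fundamentalForm J g) x with hTdef
  have hD' := hD.isCovariantDerivative
  have hon := isOrthonormalAt_orthonormalBasisAt (x := x) (hs x) (hp x)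
  have hskew := covDerivBilin_swap (D := leviCivita g) (fundamentalForm_swap hs hJ hJg) x
  have hcomm := covDerivBilin_fundamentalForm_comm hD hJ hJg hd hext
  rw [← hTdef] at hskew hcomm
  choose L hL using exists_covDerivBilin_eq hD' hd
  rw [← hTdef] at hL
  have h1 : leeForm J g x w
      = ∑ i, T (orthonormalBasisAt g x i) (orthonormalBasisAt g x i) (J x w) := by
    simp [leeForm, codifferential, hTdef]
  have h2 := trace_eq_of_orthonormal (B := g x) (hs x) hon (e := Sum.elim h fun i ↦ J x (h i))
    (by simpa using hh) (sum_isOrthonormalAt hon) (fun u v ↦ T u v (J x w))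
    (fun u v w ↦ by simp only [hTdef, covDerivBilin, map_add, add_apply]; ring)
    (fun u v w ↦ by simp only [hL, map_add, add_apply])
    (fun c u v ↦ by simp only [hTdef, covDerivBilin, map_smul, smul_apply, smul_eq_mul]; ring)
    (fun c u v ↦ by simp only [hL, map_smul, smul_apply])
  rw [h1, ← h2, Fintype.sum_sum_type, ← Finset.sum_add_distrib]
  refine Finset.sum_congr rfl fun i _ ↦ ?_
  simp only [Sum.elim_inl, Sum.elim_inr]
  have h3 : T w (h i) (J x (h i)) = 0 := by
    have := hskew w (h i) (J x (h i))
    rw [hcomm] at this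
    linarith
  have h4 : T (J x (h i)) (J x (h i)) (J x w) = T (J x (h i)) w (h i) := by
    rw [← hcomm, hJ, hskew _ w]
    simp only [hL, map_neg, neg_apply]
  rw [h3, h4, ← hcomm, add_zero]

end Hermitian

/-! ### Fields with constant components in a chart -/

section Extend

variable {F : Type*} [NormedAddCommGroup F] [NormedSpace ℝ F]
  {H : Type*} [TopologicalSpace H] {I : ModelWithCorners ℝ F H}
  {N : Type*} [TopologicalSpace N] [ChartedSpace H N] [IsManifold I 1 N]
  {ι : Type*} [Fintype ι]

lemma extend_sum_smul {x y : N} (hy : y ∈ (chartAt H x).source) (c : ι → ℝ)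
    (v : ι → TangentSpace I x) :
    extend F (∑ k, c k • v k) y = ∑ k, c k • (extend F (v k) y : TangentSpace I y) := by
  apply tangentCoord_injective hy
  rw [tangentCoord_extend hy]
  simp [tangentCoord_extend hy]

lemma eq_sum_repr_smul_extend {x y : N} (hy : y ∈ (chartAt H x).source)
    (b : Module.Basis ι ℝ (TangentSpace I x)) (v : TangentSpace I y) :
    v = ∑ k, b.repr (modelEquiv I x (tangentCoord I x y v)) k •
      (extend F (b k) y : TangentSpace I y) := by
  conv_lhs => rw [← extend_tangentCoord hy v, ← b.sum_repr (modelEquiv I x (tangentCoord I x y v))]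
  exact extend_sum_smul hy _ _

end Extend

/-! ### Exterior derivatives of 1-forms -/

section OneForm

variable {F : Type*} [NormedAddCommGroup F] [NormedSpace ℝ F]
  {H : Type*} [TopologicalSpace H] {I : ModelWithCorners ℝ F H}
  {N : Type*} [TopologicalSpace N] [ChartedSpace H N] [IsManifold I 1 N]

/-- A 1-form is differentiable at `x` if it is linear on the tangent spaces and takes vector fields
that are differentiable at `x` to functions that are differentiable at `x`. -/
structure IsDifferentiableOneFormAt (θ : OneForm I N) (x : N) : Prop where
  isLinearMap : ∀ y, IsLinearMap ℝ (θ y)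
  mdifferentiableAt : ∀ {V : Π x : N, TangentSpace I x}, MDiffAt (T% V) x →
    MDiffAt (fun y ↦ θ y (V y)) x

/-- Differentiability of a 1-form may be tested on the fields with constant components. -/
lemma isDifferentiableOneFormAt_of_extend [FiniteDimensional ℝ F] {θ : OneForm I N} {x : N}
    (hlin : ∀ y, IsLinearMap ℝ (θ y))
    (h : ∀ v : TangentSpace I x, MDiffAt (fun y ↦ θ y (extend F v y)) x) :
    IsDifferentiableOneFormAt θ x where
  isLinearMap := hlin
  mdifferentiableAt {V} hV := by
    let b := Module.finBasis ℝ (TangentSpace I x)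
    have h1 : ∀ k, MDiffAt (fun y ↦ b.repr (modelEquiv I x (tangentCoord I x y (V y))) k) x := by
      intro k
      let L : F →L[ℝ] ℝ := (LinearMap.toContinuousLinearMap (b.coord k)).comp
        (modelEquiv I x).toContinuousLinearMap
      exact (ContinuousLinearMap.mdifferentiableAt L).comp x (mdifferentiableAt_tangentCoord.1 hV)
    have h2 := (mdifferentiableAt_fun_sum (I := I) Finset.univ fun k _ ↦ (h1 k).mul (h (b k))).1
    refine h2.congr_of_eventuallyEq ?_
    filter_upwards [eventually_mem_chart_source (H := H) x] with y hy
    let L := (hlin y).mk' (θ y)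
    have hL : ∀ v, θ y v = L v := fun _ ↦ rfl
    conv_lhs => rw [eq_sum_repr_smul_extend hy b (V y)]
    simp [hL]

section

variable [IsManifold I 2 N] [CompleteSpace F] {θ : OneForm I N} {x : N}
  (hθ : IsDifferentiableOneFormAt θ x)
include hθ

lemma tensorialAt_extDerivOneForm_left (Y : Π x : N, TangentSpace I x) :
    TensorialAt I F (fun X ↦ extDerivOneForm θ X Y x) x where
  smul {f σ} hf hσ := by
    have h := mvfderiv_fun_mul (I := I) hf (hθ.mdifferentiableAt hσ)
    have hl := hθ.isLinearMap
    simp [extDerivOneForm, VectorField.mlieBracket_smul_left hf hσ, (hl _).map_add,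
      (hl _).map_smul, (hl _).map_neg, h]
    ring
  add {σ σ'} hσ hσ' := by
    have h := mvfderiv_fun_add (I := I) (hθ.mdifferentiableAt hσ) (hθ.mdifferentiableAt hσ')
    have hl := hθ.isLinearMap
    simp [extDerivOneForm, VectorField.mlieBracket_add_left hσ hσ', (hl _).map_add, h]
    ring

omit [CompleteSpace F] [IsManifold I 1 N] [IsManifold I 2 N] hθ in
lemma extDerivOneForm_swap (hl : ∀ y, IsLinearMap ℝ (θ y)) (X Y : Π x : N, TangentSpace I x) :
    extDerivOneForm θ X Y x = -extDerivOneForm θ Y X x := by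
  simp only [extDerivOneForm]
  rw [VectorField.mlieBracket_swap_apply, (hl x).map_neg]
  ring

/-- The exterior derivative of a 1-form is tensorial. -/
lemma extDerivOneForm_eq_of_eq [FiniteDimensional ℝ F] {X X' Y Y' : Π x : N, TangentSpace I x}
    (hX : MDiffAt (T% X) x) (hX' : MDiffAt (T% X') x) (hY : MDiffAt (T% Y) x)
    (hY' : MDiffAt (T% Y') x) (hXX' : X x = X' x) (hYY' : Y x = Y' x) :
    extDerivOneForm θ X Y x = extDerivOneForm θ X' Y' x := by
  have h1 : extDerivOneForm θ X Y x = extDerivOneForm θ X' Y x :=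
    (tensorialAt_extDerivOneForm_left hθ Y).pointwise hX hX' hXX'
  have h2 : extDerivOneForm θ Y X' x = extDerivOneForm θ Y' X' x :=
    (tensorialAt_extDerivOneForm_left hθ X').pointwise hY hY' hYY'
  rw [h1, extDerivOneForm_swap hθ.isLinearMap, h2, ← extDerivOneForm_swap hθ.isLinearMap]

end

lemma extDerivOneForm_sub {θ θ' : OneForm I N} {x : N} (hθ : IsDifferentiableOneFormAt θ x)
    (hθ' : IsDifferentiableOneFormAt θ' x) {X Y : Π x : N, TangentSpace I x}
    (hX : MDiffAt (T% X) x) (hY : MDiffAt (T% Y) x) :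
    extDerivOneForm (fun y v ↦ θ y v - θ' y v) X Y x
      = extDerivOneForm θ X Y x - extDerivOneForm θ' X Y x := by
  simp only [extDerivOneForm]
  rw [mvfderiv_fun_sub (hθ.mdifferentiableAt hX) (hθ'.mdifferentiableAt hX),
    mvfderiv_fun_sub (hθ.mdifferentiableAt hY) (hθ'.mdifferentiableAt hY)]
  simp only [sub_apply]
  ring

lemma IsDifferentiableOneFormAt.sub {θ θ' : OneForm I N} {x : N}
    (hθ : IsDifferentiableOneFormAt θ x) (hθ' : IsDifferentiableOneFormAt θ' x) :
    IsDifferentiableOneFormAt (fun y v ↦ θ y v - θ' y v : OneForm I N) x where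
  isLinearMap y := ((hθ.isLinearMap y).mk' _ - (hθ'.isLinearMap y).mk' _).isLinear
  mdifferentiableAt hV := (hθ.mdifferentiableAt hV).sub (hθ'.mdifferentiableAt hV)

end OneForm

/-! ### Charts of the tangent bundle and lifts -/

section TangentBundleCharts

variable {E : Type*} [NormedAddCommGroup E] [NormedSpace ℝ E]
  {M : Type*} [TopologicalSpace M] [ChartedSpace E M] [IsManifold 𝓘(ℝ, E) ∞ M]

lemma chart_source_tangentBundle {p q : TangentBundle 𝓘(ℝ, E) M}
    (hq : q.1 ∈ (chartAt E p.1).source) : q ∈ (chartAt (ModelProd E E) p).source := by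
  rw [TangentBundle.mem_chart_source_iff]
  exact hq

lemma eventually_proj_mem_chart_source (p : TangentBundle 𝓘(ℝ, E) M) :
    ∀ᶠ q : TangentBundle 𝓘(ℝ, E) M in 𝓝 p, q.1 ∈ (chartAt E p.1).source :=
  (FiberBundle.continuous_proj E (TangentSpace 𝓘(ℝ, E) : M → Type _)).continuousAt.eventually
    (eventually_mem_chart_source p.1)

/-- The differential of a map into `TM`, in a bundle chart. -/
lemma tangentCoord_mfderiv {E' : Type*} [NormedAddCommGroup E'] [NormedSpace ℝ E']
    {H' : Type*} [TopologicalSpace H'] {I' : ModelWithCorners ℝ E' H'}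
    {N : Type*} [TopologicalSpace N] [ChartedSpace H' N]
    {f : N → TangentBundle 𝓘(ℝ, E) M} {n : N} (hf : MDiffAt f n) {p : TangentBundle 𝓘(ℝ, E) M}
    (hq : (f n).1 ∈ (chartAt E p.1).source) (v : TangentSpace I' n) :
    tangentCoord 𝓘(ℝ, E).tangent p (f n) (mfderiv I' 𝓘(ℝ, E).tangent f n v)
      = mvfderiv I' (fun m ↦ (extChartAt 𝓘(ℝ, E) p.1 (f m).1,
          tangentCoord 𝓘(ℝ, E) p.1 (f m).1 (f m).2)) n v := by
  have hq' := chart_source_tangentBundle hq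
  rw [tangentCoord_eq_mfderiv hq']
  have h1 : MDifferentiableAt 𝓘(ℝ, E).tangent 𝓘(ℝ, E × E) (extChartAt 𝓘(ℝ, E).tangent p) (f n) :=
    mdifferentiableAt_extChartAt hq'
  exact (mfderiv_comp_apply n h1 hf v).symm

lemma mvfderiv_prodMk {E' : Type*} [NormedAddCommGroup E'] [NormedSpace ℝ E']
    {H' : Type*} [TopologicalSpace H'] {I' : ModelWithCorners ℝ E' H'}
    {N : Type*} [TopologicalSpace N] [ChartedSpace H' N] {G G' : Type*} [NormedAddCommGroup G]
    [NormedSpace ℝ G] [NormedAddCommGroup G'] [NormedSpace ℝ G'] {f : N → G} {f' : N → G'} {n : N}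
    (hf : MDiffAt f n) (hf' : MDiffAt f' n) (v : TangentSpace I' n) :
    mvfderiv I' (fun m ↦ (f m, f' m)) n v = (mvfderiv I' f n v, mvfderiv I' f' n v) := by
  have h := hf.prodMk_space hf'
  have h1 := mvfderiv_clm_comp (ContinuousLinearMap.fst ℝ G G') h v
  have h2 := mvfderiv_clm_comp (ContinuousLinearMap.snd ℝ G G') h v
  exact Prod.ext h1.symm h2.symm

/-- The first component of a tangent vector of `TM` in a bundle chart is the projected vector. -/
lemma fst_tangentCoord_tangentBundle {p q : TangentBundle 𝓘(ℝ, E) M}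
    (hq : q.1 ∈ (chartAt E p.1).source) (W : TangentSpace 𝓘(ℝ, E).tangent q) :
    (tangentCoord 𝓘(ℝ, E).tangent p q W).1 = tangentCoord 𝓘(ℝ, E) p.1 q.1 (dproj q W) := by
  have hq' := chart_source_tangentBundle hq
  rw [tangentCoord_eq_mfderiv hq', tangentCoord_eq_mfderiv hq]
  have hp : MDiffAt (fun q : TangentBundle 𝓘(ℝ, E) M ↦ q.1) q :=
    mdifferentiableAt_proj (TangentSpace 𝓘(ℝ, E) : M → Type _)
  have h1 : MDiffAt (extChartAt 𝓘(ℝ, E) p.1) q.1 := mdifferentiableAt_extChartAt hq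
  have h2 : MDifferentiableAt 𝓘(ℝ, E).tangent 𝓘(ℝ, E × E) (extChartAt 𝓘(ℝ, E).tangent p) q :=
    mdifferentiableAt_extChartAt hq'
  refine Eq.trans ?_ (mfderiv_comp_apply q h1 hp W)
  exact (mvfderiv_clm_comp (ContinuousLinearMap.fst ℝ E E) h2 W).symm

lemma dproj_apply (q : TangentBundle 𝓘(ℝ, E) M) (W : TangentSpace 𝓘(ℝ, E).tangent q) :
    dproj q W = modelEquiv 𝓘(ℝ, E) q.1 ((modelEquiv 𝓘(ℝ, E).tangent q).symm W).1 := by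
  have h := fst_tangentCoord_tangentBundle (mem_chart_source E q.1) W
  rw [tangentCoord_self, tangentCoord_self] at h
  rw [h]
  simp

lemma fibreComponent_apply (q : TangentBundle 𝓘(ℝ, E) M) (W : TangentSpace 𝓘(ℝ, E).tangent q) :
    fibreComponent q W = modelEquiv 𝓘(ℝ, E) q.1 ((modelEquiv 𝓘(ℝ, E).tangent q).symm W).2 := rfl

lemma verticalLift_apply (q : TangentBundle 𝓘(ℝ, E) M) (w : TangentSpace 𝓘(ℝ, E) q.1) :
    verticalLift q w
      = modelEquiv 𝓘(ℝ, E).tangent q ((0 : E), (modelEquiv 𝓘(ℝ, E) q.1).symm w) := rfl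

variable (nabla : CovariantDerivative 𝓘(ℝ, E) E (TangentSpace 𝓘(ℝ, E) : M → Type _))

lemma horizontalLift_apply (q : TangentBundle 𝓘(ℝ, E) M) (v : TangentSpace 𝓘(ℝ, E) q.1) :
    horizontalLift nabla q v
      = modelEquiv 𝓘(ℝ, E).tangent q ((modelEquiv 𝓘(ℝ, E) q.1).symm v, (0 : E))
        - verticalLift q (nabla (extend E q.2) q.1 v) := rfl

@[simp] lemma dproj_verticalLift (q : TangentBundle 𝓘(ℝ, E) M) (w : TangentSpace 𝓘(ℝ, E) q.1) :
    dproj q (verticalLift q w) = 0 := by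
  rw [dproj_apply, verticalLift_apply, ContinuousLinearEquiv.symm_apply_apply, map_zero]

@[simp] lemma fibreComponent_verticalLift (q : TangentBundle 𝓘(ℝ, E) M)
    (w : TangentSpace 𝓘(ℝ, E) q.1) : fibreComponent q (verticalLift q w) = w := by
  rw [fibreComponent_apply, verticalLift_apply, ContinuousLinearEquiv.symm_apply_apply,
    ContinuousLinearEquiv.apply_symm_apply]

@[simp] lemma dproj_horizontalLift (q : TangentBundle 𝓘(ℝ, E) M) (v : TangentSpace 𝓘(ℝ, E) q.1) :
    dproj q (horizontalLift nabla q v) = v := by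
  rw [horizontalLift_apply, map_sub, dproj_verticalLift, dproj_apply,
    ContinuousLinearEquiv.symm_apply_apply, ContinuousLinearEquiv.apply_symm_apply, sub_zero]

lemma connectionMap_apply (q : TangentBundle 𝓘(ℝ, E) M) (W : TangentSpace 𝓘(ℝ, E).tangent q) :
    connectionMap nabla q W = fibreComponent q W + nabla (extend E q.2) q.1 (dproj q W) := rfl

@[simp] lemma connectionMap_verticalLift (q : TangentBundle 𝓘(ℝ, E) M)
    (w : TangentSpace 𝓘(ℝ, E) q.1) : connectionMap nabla q (verticalLift q w) = w := by
  simp [connectionMap_apply]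

@[simp] lemma connectionMap_horizontalLift (q : TangentBundle 𝓘(ℝ, E) M)
    (v : TangentSpace 𝓘(ℝ, E) q.1) : connectionMap nabla q (horizontalLift nabla q v) = 0 := by
  rw [connectionMap_apply, dproj_horizontalLift, horizontalLift_apply, map_sub,
    fibreComponent_verticalLift, fibreComponent_apply, ContinuousLinearEquiv.symm_apply_apply,
    map_zero]
  abel

lemma ext_dproj_fibreComponent {q : TangentBundle 𝓘(ℝ, E) M}
    {W W' : TangentSpace 𝓘(ℝ, E).tangent q} (h : dproj q W = dproj q W')
    (h' : fibreComponent q W = fibreComponent q W') : W = W' := by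
  rw [dproj_apply, dproj_apply] at h
  rw [fibreComponent_apply, fibreComponent_apply] at h'
  apply (modelEquiv 𝓘(ℝ, E).tangent q).symm.injective
  exact Prod.ext ((modelEquiv 𝓘(ℝ, E) q.1).injective h) ((modelEquiv 𝓘(ℝ, E) q.1).injective h')

/-- The decomposition of a tangent vector of `TM` in its horizontal and vertical parts. -/
lemma horizontalLift_add_verticalLift (q : TangentBundle 𝓘(ℝ, E) M)
    (W : TangentSpace 𝓘(ℝ, E).tangent q) :
    horizontalLift nabla q (dproj q W) + verticalLift q (connectionMap nabla q W) = W := by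
  have key (W W' : TangentSpace 𝓘(ℝ, E).tangent q) (h : dproj q W = dproj q W')
      (h' : connectionMap nabla q W = connectionMap nabla q W') : W = W' := by
    refine ext_dproj_fibreComponent h ?_
    rwa [connectionMap_apply, connectionMap_apply, h, add_left_inj] at h'
  apply key <;> simp

lemma ext_dproj_connectionMap {q : TangentBundle 𝓘(ℝ, E) M}
    {W W' : TangentSpace 𝓘(ℝ, E).tangent q} (h : dproj q W = dproj q W')
    (h' : connectionMap nabla q W = connectionMap nabla q W') : W = W' := by
  rw [← horizontalLift_add_verticalLift nabla q W, h, h', horizontalLift_add_verticalLift]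

/-- The inclusion of the fibre of `TM` at `y`, parametrized by the model space. -/
abbrev fibreInclusion (y : M) (s : E) : TangentBundle 𝓘(ℝ, E) M := ⟨y, modelEquiv 𝓘(ℝ, E) y s⟩

lemma mdifferentiableAt_fibreInclusion (y : M) (z : E) :
    MDifferentiableAt 𝓘(ℝ, E) 𝓘(ℝ, E).tangent (fibreInclusion y) z := by
  rw [mdifferentiableAt_totalSpace]
  exact ⟨mdifferentiableAt_const, ((tangentCoord 𝓘(ℝ, E) y y).comp
    (modelEquiv 𝓘(ℝ, E) y).toContinuousLinearMap).mdifferentiableAt⟩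

/-- Bundle charts are linear on the fibres. -/
lemma tangentCoord_mfderiv_fibreInclusion {y : M} {p : TangentBundle 𝓘(ℝ, E) M}
    (hy : y ∈ (chartAt E p.1).source) (z w : E) :
    tangentCoord 𝓘(ℝ, E).tangent p (fibreInclusion y z)
        (mfderiv 𝓘(ℝ, E) 𝓘(ℝ, E).tangent (fibreInclusion y) z (modelEquiv 𝓘(ℝ, E) z w))
      = ((0 : E), tangentCoord 𝓘(ℝ, E) p.1 y (modelEquiv 𝓘(ℝ, E) y w)) := by
  let L : E →L[ℝ] E :=
    (tangentCoord 𝓘(ℝ, E) p.1 y).comp (modelEquiv 𝓘(ℝ, E) y).toContinuousLinearMap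
  rw [tangentCoord_mfderiv (mdifferentiableAt_fibreInclusion y z) (p := p) hy]
  refine (mvfderiv_prodMk (f := fun _ ↦ extChartAt 𝓘(ℝ, E) p.1 y) (f' := L)
    mdifferentiableAt_const L.mdifferentiableAt _).trans ?_
  rw [mvfderiv_const]
  exact Prod.ext rfl (DFunLike.congr_fun L.mfderiv_eq w)

/-- Vertical vectors are the tangent vectors of the fibres. -/
lemma mfderiv_fibreInclusion (y : M) (z w : E) :
    mfderiv 𝓘(ℝ, E) 𝓘(ℝ, E).tangent (fibreInclusion y) z (modelEquiv 𝓘(ℝ, E) z w)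
      = verticalLift (fibreInclusion y z) (modelEquiv 𝓘(ℝ, E) y w) := by
  have h := tangentCoord_mfderiv_fibreInclusion (p := fibreInclusion y z)
    (mem_chart_source E y) z w
  rw [tangentCoord_self, ContinuousLinearEquiv.symm_apply_eq] at h
  refine h.trans (congrArg (modelEquiv 𝓘(ℝ, E).tangent (fibreInclusion y z)) (Prod.ext rfl ?_))
  exact tangentCoord_self y _

lemma tangentCoord_verticalLift {p q : TangentBundle 𝓘(ℝ, E) M}
    (hq : q.1 ∈ (chartAt E p.1).source) (w : TangentSpace 𝓘(ℝ, E) q.1) :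
    tangentCoord 𝓘(ℝ, E).tangent p q (verticalLift q w)
      = ((0 : E), tangentCoord 𝓘(ℝ, E) p.1 q.1 w) := by
  obtain ⟨y, u⟩ := q
  obtain ⟨z, rfl⟩ := (modelEquiv 𝓘(ℝ, E) y).surjective u
  obtain ⟨w, rfl⟩ := (modelEquiv 𝓘(ℝ, E) y).surjective w
  change tangentCoord 𝓘(ℝ, E).tangent p (fibreInclusion y z)
    (verticalLift (fibreInclusion y z) (modelEquiv 𝓘(ℝ, E) y w)) = _
  rw [← mfderiv_fibreInclusion]
  exact tangentCoord_mfderiv_fibreInclusion hq z w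

/-- The differential of a section of `TM`, in a bundle chart. -/
lemma tangentCoord_mfderiv_section {Y : Π x : M, TangentSpace 𝓘(ℝ, E) x} {y : M}
    (hY : MDiffAt (T% Y) y) {p : TangentBundle 𝓘(ℝ, E) M} (hy : y ∈ (chartAt E p.1).source)
    (v : TangentSpace 𝓘(ℝ, E) y) :
    tangentCoord 𝓘(ℝ, E).tangent p ⟨y, Y y⟩ (mfderiv 𝓘(ℝ, E) 𝓘(ℝ, E).tangent (T% Y) y v)
      = (tangentCoord 𝓘(ℝ, E) p.1 y v,
        mvfderiv 𝓘(ℝ, E) (fun y' ↦ tangentCoord 𝓘(ℝ, E) p.1 y' (Y y')) y v) := by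
  have h1 : MDiffAt (extChartAt 𝓘(ℝ, E) p.1) y := mdifferentiableAt_extChartAt hy
  have h2 : MDiffAt (fun y' ↦ tangentCoord 𝓘(ℝ, E) p.1 y' (Y y')) y :=
    ((trivializationAt E (TangentSpace 𝓘(ℝ, E)) p.1).mdifferentiableAt_section_iff
      𝓘(ℝ, E) Y hy).1 hY
  refine (tangentCoord_mfderiv hY (p := p) hy v).trans ?_
  refine (mvfderiv_prodMk h1 h2 v).trans (Prod.ext ?_ rfl)
  rw [tangentCoord_eq_mfderiv hy]
  rfl

variable [FiniteDimensional ℝ E]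

/-- The differential of a section of `TM` has vertical part the covariant derivative. -/
lemma mfderiv_section {Y : Π x : M, TangentSpace 𝓘(ℝ, E) x} {y : M}
    (hY : MDiffAt (T% Y) y) (v : TangentSpace 𝓘(ℝ, E) y) :
    mfderiv 𝓘(ℝ, E) 𝓘(ℝ, E).tangent (T% Y) y v
      = horizontalLift nabla ⟨y, Y y⟩ v + verticalLift ⟨y, Y y⟩ (nabla Y y v) := by
  have h := tangentCoord_mfderiv_section hY (p := ⟨y, Y y⟩) (mem_chart_source E y) v
  rw [tangentCoord_self, ContinuousLinearEquiv.symm_apply_eq] at h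
  rw [h, horizontalLift_apply, sub_add, ← map_sub,
    covariantDerivative_eq_chartDeriv_add nabla.isCovariantDerivativeOnUniv hY, add_apply,
    sub_add_cancel_right, map_neg, sub_neg_eq_add, verticalLift_apply, ← map_add,
    chartDeriv_apply, tangentCoord_self]
  congr 1
  simp

/-- The horizontal lift in a bundle chart. -/
lemma tangentCoord_horizontalLift {p q : TangentBundle 𝓘(ℝ, E) M}
    (hq : q.1 ∈ (chartAt E p.1).source) (v : TangentSpace 𝓘(ℝ, E) q.1) :
    tangentCoord 𝓘(ℝ, E).tangent p q (horizontalLift nabla q v)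
      = (tangentCoord 𝓘(ℝ, E) p.1 q.1 v, -tangentCoord 𝓘(ℝ, E) p.1 q.1
          (nabla (extend E (modelEquiv 𝓘(ℝ, E) p.1 (tangentCoord 𝓘(ℝ, E) p.1 q.1 q.2)))
            q.1 v)) := by
  obtain ⟨y, u⟩ := q
  -- the field through `u` with constant components in the chart at the base point of `p`
  let Y : Π x : M, TangentSpace 𝓘(ℝ, E) x :=
    extend E (modelEquiv 𝓘(ℝ, E) p.1 (tangentCoord 𝓘(ℝ, E) p.1 y u))
  have hYy : Y y = u := extend_tangentCoord hq u
  have hY : MDiffAt (T% Y) y := by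
    refine ((trivializationAt E (TangentSpace 𝓘(ℝ, E)) p.1).mdifferentiableAt_section_iff
      𝓘(ℝ, E) Y hq).2 ?_
    refine (mdifferentiableAt_const (c := tangentCoord 𝓘(ℝ, E) p.1 y u)).congr_of_eventuallyEq ?_
    filter_upwards [(chartAt E p.1).open_source.mem_nhds hq] with y' hy'
    exact (tangentCoord_extend hy' _).trans (by simp)
  have h1 := tangentCoord_mfderiv_section hY hq v
  rw [mvfderiv_congr (f' := fun _ ↦ tangentCoord 𝓘(ℝ, E) p.1 y u)
    (by
      filter_upwards [(chartAt E p.1).open_source.mem_nhds hq] with y' hy'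
      exact (tangentCoord_extend hy' _).trans (by simp)), mvfderiv_const, mfderiv_section nabla hY,
    map_add, tangentCoord_verticalLift (q := ⟨y, Y y⟩) hq, ← eq_sub_iff_add_eq] at h1
  have h2 : tangentCoord 𝓘(ℝ, E).tangent p ⟨y, Y y⟩ (horizontalLift nabla ⟨y, Y y⟩ v)
      = (tangentCoord 𝓘(ℝ, E) p.1 y v, -tangentCoord 𝓘(ℝ, E) p.1 y (nabla Y y v)) := by
    rw [h1]
    simp
  have key (u' : TangentSpace 𝓘(ℝ, E) y) (hu : Y y = u') :
      tangentCoord 𝓘(ℝ, E).tangent p ⟨y, u'⟩ (horizontalLift nabla ⟨y, u'⟩ v)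
        = (tangentCoord 𝓘(ℝ, E) p.1 y v, -tangentCoord 𝓘(ℝ, E) p.1 y (nabla Y y v)) := by
    subst hu
    exact h2
  exact key u hYy

end TangentBundleCharts

/-! ### Germs of smooth vector fields -/

section SmoothNear

variable {E : Type*} [NormedAddCommGroup E] [NormedSpace ℝ E]
  {M : Type*} [TopologicalSpace M] [ChartedSpace E M] [IsManifold 𝓘(ℝ, E) ∞ M]

/-- The vector field `V` is smooth on a neighbourhood of `x`. -/
def IsSmoothNear (V : Π x : M, TangentSpace 𝓘(ℝ, E) x) (x : M) : Prop :=
  ∀ᶠ y in 𝓝 x, CMDiffAt ∞ (T% V) y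

variable {V W : Π x : M, TangentSpace 𝓘(ℝ, E) x} {x : M}

lemma isSmoothNear_extend (v : TangentSpace 𝓘(ℝ, E) x) : IsSmoothNear (extend E v) x := by
  obtain ⟨s, hs, h⟩ := exists_contMDiffOn_extend (k := ∞) 𝓘(ℝ, E) E v
  filter_upwards [eventually_mem_nhds_iff.2 hs] with y hy using h.contMDiffAt hy

lemma IsSmoothNear.mdifferentiableAt (hV : IsSmoothNear V x) : MDiffAt (T% V) x :=
  hV.self_of_nhds.mdifferentiableAt (by simp)

lemma IsSmoothNear.eventually (hV : IsSmoothNear V x) : ∀ᶠ y in 𝓝 x, IsSmoothNear V y :=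
  eventually_eventually_nhds.2 hV

lemma IsSmoothNear.congr (hV : IsSmoothNear V x) (h : ∀ᶠ y in 𝓝 x, V y = W y) :
    IsSmoothNear W x := by
  filter_upwards [hV, eventually_eventually_nhds.2 h] with y hy h'
  exact hy.congr_of_eventuallyEq (h'.mono fun z hz ↦ by simp [hz])

lemma IsSmoothNear.sub (hV : IsSmoothNear V x) (hW : IsSmoothNear W x) :
    IsSmoothNear (fun y ↦ V y - W y) x := by
  filter_upwards [hV, hW] with y h1 h2 using h1.sub_section h2

lemma isSmoothNear_sum {ι : Type*} {V : ι → Π x : M, TangentSpace 𝓘(ℝ, E) x} (s : Finset ι)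
    (hV : ∀ i ∈ s, IsSmoothNear (V i) x) : IsSmoothNear (fun y ↦ ∑ i ∈ s, V i y) x := by
  have h : ∀ᶠ y in 𝓝 x, ∀ i ∈ s, CMDiffAt ∞ (T% (V i)) y := (Filter.eventually_all_finset s).2 hV
  filter_upwards [h] with y hy using ContMDiffAt.sum_section hy

lemma IsSmoothNear.smul {f : M → ℝ} (hf : ∀ᶠ y in 𝓝 x, CMDiffAt ∞ f y) (hV : IsSmoothNear V x) :
    IsSmoothNear (fun y ↦ f y • V y) x := by
  filter_upwards [hf, hV] with y h1 h2 using h1.smul_section h2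

variable [FiniteDimensional ℝ E] [T2Space M]

/-- A cutoff extends the germ of a smooth vector field. -/
lemma IsSmoothNear.exists_contMDiff (hV : IsSmoothNear V x) :
    ∃ W : Π x : M, TangentSpace 𝓘(ℝ, E) x, CMDiff ∞ (T% W) ∧ ∀ᶠ y in 𝓝 x, V y = W y := by
  obtain ⟨u, hu, huo, hxu⟩ := eventually_nhds_iff.1 hV
  obtain ⟨f, -, hf⟩ := (SmoothBumpFunction.nhds_basis_tsupport (I := 𝓘(ℝ, E)) x).mem_iff.1
    (huo.mem_nhds hxu)
  refine ⟨(f : M → ℝ) • V, ContMDiffOn.smul_section_of_tsupport f.contMDiff.contMDiffOn huo hf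
    fun y hy ↦ (hu y hy).contMDiffWithinAt, ?_⟩
  filter_upwards [f.eventuallyEq_one] with y hy
  simp [hy]

variable {nabla : CovariantDerivative 𝓘(ℝ, E) E (TangentSpace 𝓘(ℝ, E) : M → Type _)}
variable (hsmooth : nabla.ContMDiffCovariantDerivative ∞)

omit [T2Space M] [FiniteDimensional ℝ E] in
lemma contMDiff_covariantDerivative (hsmooth : nabla.ContMDiffCovariantDerivative ∞)
    (hV : CMDiff ∞ (T% V)) (hW : CMDiff ∞ (T% W)) : CMDiff ∞ (T% (fun y ↦ nabla V y (W y))) := by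
  have h := hsmooth.contMDiff.contMDiff (σ := V) (contMDiffOn_univ.2 hV)
  exact (contMDiffOn_univ.1 h).clm_bundle_apply hW

omit [T2Space M] [FiniteDimensional ℝ E] in
lemma covariantDerivative_congr (hV : IsSmoothNear V x) (h : ∀ᶠ y in 𝓝 x, V y = W y) :
    ∀ᶠ y in 𝓝 x, nabla V y = nabla W y := by
  filter_upwards [hV.eventually, (hV.congr h).eventually, eventually_eventually_nhds.2 h]
    with y h1 h2 h3
  exact nabla.isCovariantDerivativeOnUniv.congr_of_eventuallyEq h1.mdifferentiableAt
    h2.mdifferentiableAt Filter.univ_mem h3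

include hsmooth in
lemma IsSmoothNear.covariantDerivative (hV : IsSmoothNear V x) (hW : IsSmoothNear W x) :
    IsSmoothNear (fun y ↦ nabla V y (W y)) x := by
  obtain ⟨V', hV', hVV'⟩ := hV.exists_contMDiff
  obtain ⟨W', hW', hWW'⟩ := hW.exists_contMDiff
  refine IsSmoothNear.congr (V := fun y ↦ nabla V' y (W' y))
    (.of_forall (contMDiff_covariantDerivative hsmooth hV' hW')) ?_
  filter_upwards [covariantDerivative_congr (nabla := nabla) hV hVV', hWW'] with y h1 h2
  rw [h1, h2]

include hsmooth in
/-- The curvature of a flat connection vanishes on germs of smooth vector fields. -/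
lemma IsFlat.curvature_eq_zero (hflat : IsFlat nabla) {X Y Z : Π x : M, TangentSpace 𝓘(ℝ, E) x}
    (hX : IsSmoothNear X x) (hY : IsSmoothNear Y x) (hZ : IsSmoothNear Z x) :
    nabla (fun y ↦ nabla Z y (Y y)) x (X x) - nabla (fun y ↦ nabla Z y (X y)) x (Y x)
      - nabla Z x (VectorField.mlieBracket 𝓘(ℝ, E) X Y x) = 0 := by
  obtain ⟨X', hX', hXX'⟩ := hX.exists_contMDiff
  obtain ⟨Y', hY', hYY'⟩ := hY.exists_contMDiff
  obtain ⟨Z', hZ', hZZ'⟩ := hZ.exists_contMDiff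
  have hc := covariantDerivative_congr (nabla := nabla) hZ hZZ'
  have h1 : nabla (fun y ↦ nabla Z y (Y y)) x = nabla (fun y ↦ nabla Z' y (Y' y)) x := by
    refine (covariantDerivative_congr (hZ.covariantDerivative hsmooth hY) ?_).self_of_nhds
    filter_upwards [hc, hYY'] with y h1 h2
    rw [h1, h2]
  have h2 : nabla (fun y ↦ nabla Z y (X y)) x = nabla (fun y ↦ nabla Z' y (X' y)) x := by
    refine (covariantDerivative_congr (hZ.covariantDerivative hsmooth hX) ?_).self_of_nhds
    filter_upwards [hc, hXX'] with y h1 h2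
    rw [h1, h2]
  have h3 : VectorField.mlieBracket 𝓘(ℝ, E) X Y x = VectorField.mlieBracket 𝓘(ℝ, E) X' Y' x :=
    Filter.EventuallyEq.mlieBracket_vectorField_eq hXX' hYY'
  rw [h1, h2, h3, hc.self_of_nhds, hXX'.self_of_nhds, hYY'.self_of_nhds]
  exact hflat X' Y' Z' hX' hY' hZ' x

end SmoothNear

/-! ### Smooth metrics and orthonormal frames -/

section SmoothMetric

variable {E : Type*} [NormedAddCommGroup E] [NormedSpace ℝ E]
  {M : Type*} [TopologicalSpace M] [ChartedSpace E M] [IsManifold 𝓘(ℝ, E) ∞ M]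
  (g : ContMDiffRiemannianMetric 𝓘(ℝ, E) ∞ E (TangentSpace 𝓘(ℝ, E) : M → Type _))

/-- The scalar product of two differentiable fields along a map is differentiable. -/
lemma mdifferentiableAt_metric {F : Type*} [NormedAddCommGroup F] [NormedSpace ℝ F]
    {H : Type*} [TopologicalSpace H] {I : ModelWithCorners ℝ F H}
    {N : Type*} [TopologicalSpace N] [ChartedSpace H N] {b : N → M}
    {V W : Π n : N, TangentSpace 𝓘(ℝ, E) (b n)} {n : N}
    (hV : MDifferentiableAt I 𝓘(ℝ, E).tangent (fun n ↦ (⟨b n, V n⟩ : TangentBundle 𝓘(ℝ, E) M)) n)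
    (hW : MDifferentiableAt I 𝓘(ℝ, E).tangent (fun n ↦ (⟨b n, W n⟩ : TangentBundle 𝓘(ℝ, E) M)) n) :
    MDiffAt (fun n ↦ g.inner (b n) (V n) (W n)) n := by
  have hb : MDiffAt b n := ((mdifferentiableAt_totalSpace 𝓘(ℝ, E)
    (fun n ↦ (⟨b n, V n⟩ : TangentBundle 𝓘(ℝ, E) M))).1 hV).1
  have hg : MDiffAt (fun b ↦ TotalSpace.mk' (E →L[ℝ] E →L[ℝ] ℝ) (E := fun b ↦
      (TangentSpace 𝓘(ℝ, E) b →L[ℝ] TangentSpace 𝓘(ℝ, E) b →L[ℝ] ℝ)) b (g.inner b)) (b n) :=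
    (g.contMDiff (b n)).mdifferentiableAt (by simp)
  have : MDifferentiableAt I (𝓘(ℝ, E).prod 𝓘(ℝ))
      (fun m ↦ TotalSpace.mk' ℝ (E := Bundle.Trivial M ℝ) (b m) (g.inner (b m) (V m) (W m))) n := by
    apply MDifferentiableAt.clm_bundle_apply₂ (F₁ := E) (F₂ := E) (b := b) ?_ hV hW
    exact hg.comp n hb
  simp only [mdifferentiableAt_totalSpace] at this
  exact this.2

lemma contMDiffAt_metric {V W : Π x : M, TangentSpace 𝓘(ℝ, E) x} {x : M}
    (hV : CMDiffAt ∞ (T% V) x) (hW : CMDiffAt ∞ (T% W) x) :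
    CMDiffAt ∞ (fun y ↦ g.inner y (V y) (W y)) x := by
  have : ContMDiffAt 𝓘(ℝ, E) (𝓘(ℝ, E).prod 𝓘(ℝ)) ∞
      (fun m ↦ TotalSpace.mk' ℝ (E := Bundle.Trivial M ℝ) m (g.inner m (V m) (W m))) x := by
    apply ContMDiffAt.clm_bundle_apply₂ (F₁ := E) (F₂ := E) ?_ hV hW
    exact g.contMDiff x
  simp only [contMDiffAt_totalSpace] at this
  exact this.2

lemma isDifferentiableBilinAt_metric (x : M) : IsDifferentiableBilinAt g.inner x :=
  fun hV hW ↦ mdifferentiableAt_metric g hV hW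

/-- The Levi-Civita connection of a smooth metric exists, so that the choice in `leviCivita` is not
a junk value. -/
lemma isLeviCivita_metric [FiniteDimensional ℝ E] :
    IsLeviCivita g.inner (leviCivita g.inner) :=
  isLeviCivita_leviCivita g.symm g.pos (isDifferentiableBilinAt_metric g)

lemma isOrthonormalAt_metric [FiniteDimensional ℝ E] (x : M) :
    IsOrthonormalAt g.inner x (orthonormalBasisAt g.inner x) :=
  isOrthonormalAt_orthonormalBasisAt (g.symm x) (g.pos x)

/-- The Gram-Schmidt process extends an orthonormal basis to a smooth local orthonormal frame. -/
lemma exists_orthonormalFrame {x : M} {e : Fin (Module.finrank ℝ E) → TangentSpace 𝓘(ℝ, E) x}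
    (he : IsOrthonormalAt g.inner x e) :
    ∃ f : Fin (Module.finrank ℝ E) → Π x : M, TangentSpace 𝓘(ℝ, E) x,
      (∀ i, f i x = e i) ∧ (∀ i, IsSmoothNear (f i) x) ∧
      ∀ᶠ y in 𝓝 x, IsOrthonormalAt g.inner y (fun i ↦ f i y) := by
  suffices h : ∀ s : Finset (Fin (Module.finrank ℝ E)),
      ∃ f : Fin (Module.finrank ℝ E) → Π x : M, TangentSpace 𝓘(ℝ, E) x,
      (∀ i, f i x = e i) ∧ (∀ i, IsSmoothNear (f i) x) ∧
      ∀ᶠ y in 𝓝 x, ∀ i ∈ s, ∀ j ∈ s, g.inner y (f i y) (f j y) = if i = j then 1 else 0 by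
    obtain ⟨f, h1, h2, h3⟩ := h Finset.univ
    exact ⟨f, h1, h2, h3.mono fun y hy i j ↦ hy i (Finset.mem_univ _) j (Finset.mem_univ _)⟩
  intro s
  induction s using Finset.induction_on with
  | empty =>
    exact ⟨fun i ↦ extend E (e i), fun i ↦ by simp, fun i ↦ isSmoothNear_extend _, by simp⟩
  | insert a s ha ih =>
    obtain ⟨f, h1, h2, h3⟩ := ih
    -- subtract from `f a` its projection to the span of the previous fields, then normalize
    let u : Π x : M, TangentSpace 𝓘(ℝ, E) x :=
      fun y ↦ f a y - ∑ i ∈ s, g.inner y (f a y) (f i y) • f i y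
    have hsm {V W : Π x : M, TangentSpace 𝓘(ℝ, E) x} (hV : IsSmoothNear V x)
        (hW : IsSmoothNear W x) : ∀ᶠ y in 𝓝 x, CMDiffAt ∞ (fun y ↦ g.inner y (V y) (W y)) y := by
      filter_upwards [hV, hW] with y h1 h2 using contMDiffAt_metric g h1 h2
    have hu : IsSmoothNear u x :=
      (h2 a).sub (isSmoothNear_sum s fun i _ ↦ IsSmoothNear.smul (hsm (h2 a) (h2 i)) (h2 i))
    have hux : u x = e a := by
      have : ∀ i ∈ s, g.inner x (f a x) (f i x) • f i x = 0 := by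
        intro i hi
        rw [h1, h1, he, if_neg (by rintro rfl; exact ha hi), zero_smul]
      simp only [u]
      rw [Finset.sum_eq_zero this, h1, sub_zero]
    have hn : ∀ᶠ y in 𝓝 x, 0 < g.inner y (u y) (u y) := by
      have hc := (hsm hu hu).self_of_nhds.continuousAt
      refine hc.eventually (lt_mem_nhds ?_)
      simp [hux, he a a]
    let c : M → ℝ := fun y ↦ (Real.sqrt (g.inner y (u y) (u y)))⁻¹
    have hc : ∀ᶠ y in 𝓝 x, CMDiffAt ∞ c y := by
      filter_upwards [hsm hu hu, hn] with y hy hy'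
      have hφ : ContDiffAt ℝ ∞ (fun t : ℝ ↦ (Real.sqrt t)⁻¹) (g.inner y (u y) (u y)) :=
        (Real.contDiffAt_sqrt hy'.ne').inv (Real.sqrt_pos.2 hy').ne'
      exact ContMDiffAt.comp (g := fun t : ℝ ↦ (Real.sqrt t)⁻¹) (I' := 𝓘(ℝ, ℝ)) y hφ.contMDiffAt hy
    let w : Π x : M, TangentSpace 𝓘(ℝ, E) x := fun y ↦ c y • u y
    have hw : IsSmoothNear w x := hu.smul hc
    have hwx : w x = e a := by
      have : c x = 1 := by simp [c, hux, he a a]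
      simp [w, this, hux]
    have hws : ∀ᶠ y in 𝓝 x, ∀ j ∈ s, g.inner y (w y) (f j y) = 0 := by
      filter_upwards [h3] with y hy j hj
      have : ∑ i ∈ s, g.inner y (f a y) (f i y) * g.inner y (f i y) (f j y)
          = g.inner y (f a y) (f j y) := by
        rw [Finset.sum_eq_single_of_mem j hj fun i hi hij ↦ by rw [hy i hi j hj, if_neg hij,
          mul_zero], hy j hj j hj, if_pos rfl, mul_one]
      simp [w, u, this]
    have hww : ∀ᶠ y in 𝓝 x, g.inner y (w y) (w y) = 1 := by
      filter_upwards [hn] with y hy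
      have h := Real.mul_self_sqrt hy.le
      have h' := (Real.sqrt_pos.2 hy).ne'
      simp only [w, map_smul, smul_apply, smul_eq_mul, c]
      field_simp
      rw [sq]
      exact h.symm
    refine ⟨Function.update f a w, fun i ↦ ?_, fun i ↦ ?_, ?_⟩
    · rcases eq_or_ne i a with rfl | hi
      · simpa using hwx
      · simpa [hi] using h1 i
    · rcases eq_or_ne i a with rfl | hi
      · simpa using hw
      · simpa [hi] using h2 i
    · filter_upwards [h3, hws, hww] with y h4 h5 h6 i hi j hj
      rcases eq_or_ne i a with rfl | hia <;> rcases eq_or_ne j i with rfl | hij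
      · simpa using h6
      · simpa [hij, hij.symm] using h5 j (Finset.mem_of_mem_insert_of_ne hj hij)
      · simpa [hia] using h4 j (Finset.mem_of_mem_insert_of_ne hi hia) j
          (Finset.mem_of_mem_insert_of_ne hi hia)
      · rcases eq_or_ne j a with rfl | hja
        · simpa [hia, hij.symm] using (g.symm y _ _).trans
            (h5 i (Finset.mem_of_mem_insert_of_ne hi hia))
        · simpa [hia, hja] using h4 i (Finset.mem_of_mem_insert_of_ne hi hia) j
            (Finset.mem_of_mem_insert_of_ne hj hja)

end SmoothMetric

/-! ### The Koszul forms -/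

section Koszul

variable {E : Type*} [NormedAddCommGroup E] [NormedSpace ℝ E] [FiniteDimensional ℝ E]
  {M : Type*} [TopologicalSpace M] [ChartedSpace E M] [IsManifold 𝓘(ℝ, E) ∞ M]
  (nabla : CovariantDerivative 𝓘(ℝ, E) E (TangentSpace 𝓘(ℝ, E) : M → Type _))
  (g : ContMDiffRiemannianMetric 𝓘(ℝ, E) ∞ E (TangentSpace 𝓘(ℝ, E) : M → Type _))

/-- The difference tensor may be computed with any differentiable extension of its argument. -/
lemma differenceTensor_eq {V : Π x : M, TangentSpace 𝓘(ℝ, E) x} {x : M} (hV : MDiffAt (T% V) x)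
    (v : TangentSpace 𝓘(ℝ, E) x) :
    differenceTensor nabla g.inner x v (V x) = leviCivita g.inner V x v - nabla V x v := by
  rw [covariantDerivative_eq_chartDeriv_add (isLeviCivita_metric g).isCovariantDerivative hV,
    covariantDerivative_eq_chartDeriv_add nabla.isCovariantDerivativeOnUniv hV, differenceTensor,
    add_apply, add_apply]
  abel

/-- The difference tensor as a field of bilinear maps. -/
lemma exists_differenceTensor_eq (x : M) :
    ∃ A : TangentSpace 𝓘(ℝ, E) x →L[ℝ] TangentSpace 𝓘(ℝ, E) x →L[ℝ] TangentSpace 𝓘(ℝ, E) x,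
      ∀ v w, differenceTensor nabla g.inner x v w = A w v := by
  refine ⟨(isLeviCivita_metric g).isCovariantDerivative.difference
    nabla.isCovariantDerivativeOnUniv x, fun v w ↦ ?_⟩
  have h := IsCovariantDerivativeOn.difference_apply (isLeviCivita_metric g).isCovariantDerivative
    nabla.isCovariantDerivativeOnUniv (x := x) trivial (mdifferentiableAt_extend 𝓘(ℝ, E) E w)
  rw [extend_apply_self] at h
  rw [h]
  rfl

variable {nabla} in
/-- The difference of two torsion free connections is symmetric. -/
lemma differenceTensor_swap (htorsion : nabla.torsion = 0) (x : M)
    (v w : TangentSpace 𝓘(ℝ, E) x) :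
    differenceTensor nabla g.inner x v w = differenceTensor nabla g.inner x w v := by
  have hv := mdifferentiableAt_extend 𝓘(ℝ, E) E v
  have hw := mdifferentiableAt_extend 𝓘(ℝ, E) E w
  have h1 := (isLeviCivita_metric g).torsion_free hv hw
  rw [← nabla.torsion_eq_zero_iff.1 htorsion hv hw] at h1
  simp only [extend_apply_self] at h1
  rw [differenceTensor, differenceTensor, sub_eq_sub_iff_sub_eq_sub]
  exact h1

/-- The adjoint Koszul form in an arbitrary orthonormal basis. -/
lemma adjointKoszulForm_eq_sum {x : M} {e : Fin (Module.finrank ℝ E) → TangentSpace 𝓘(ℝ, E) x}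
    (he : IsOrthonormalAt g.inner x e) (v : TangentSpace 𝓘(ℝ, E) x) :
    adjointKoszulForm nabla g.inner x v
      = ∑ i, g.inner x (differenceTensor nabla g.inner x (e i) (e i)) v := by
  obtain ⟨A, hA⟩ := exists_differenceTensor_eq nabla g x
  have he' := isOrthonormalAt_metric g x
  rw [adjointKoszulForm, metricTrace, map_sum, sum_apply]
  exact trace_eq_of_orthonormal (g.symm x) he (sum_isOrthonormalAt he') (sum_isOrthonormalAt he)
    (fun a b ↦ g.inner x (differenceTensor nabla g.inner x a b) v) (by simp [hA]) (by simp [hA])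
    (by simp [hA]) (by simp [hA])

/-- In an orthonormal basis, `∑ i, ⟨γ^*_{e_i} e_i, v⟩ = ∑ i, ⟨e_i, γ_{e_i} v⟩`. -/
lemma firstKoszulForm_eq_sum {x : M} {e : Fin (Module.finrank ℝ E) → TangentSpace 𝓘(ℝ, E) x}
    (he : IsOrthonormalAt g.inner x e) (v : TangentSpace 𝓘(ℝ, E) x) :
    firstKoszulForm nabla g.inner x v
      = ∑ i, g.inner x (differenceTensor nabla g.inner x (e i) v) (e i) := by
  obtain ⟨A, hA⟩ := exists_differenceTensor_eq nabla g x
  have he' := isOrthonormalAt_metric g x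
  rw [firstKoszulForm, metricTrace, map_sum, sum_apply]
  refine Eq.trans (Finset.sum_congr rfl fun i _ ↦ ?_)
    (trace_eq_of_orthonormal (g.symm x) he (sum_isOrthonormalAt he') (sum_isOrthonormalAt he)
      (fun a b ↦ g.inner x (differenceTensor nabla g.inner x a v) b) (by simp [hA]) (by simp [hA])
      (by simp [hA]) (by simp [hA]))
  conv_rhs => rw [← sum_isOrthonormalAt he' v]
  simp only [adjointDifferenceTensor, hA, map_sum, map_smul, sum_apply, smul_apply, smul_eq_mul]
  refine Finset.sum_congr rfl fun j _ ↦ ?_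
  rw [g.symm x _ v, mul_comm, g.symm x (orthonormalBasisAt g.inner x i)]

variable {nabla} in
/-- By the symmetry of `γ`, the first Koszul form is `v ↦ tr γ_v`. -/
lemma firstKoszulForm_eq_sum_of_torsion_eq_zero (htorsion : nabla.torsion = 0) {x : M}
    {e : Fin (Module.finrank ℝ E) → TangentSpace 𝓘(ℝ, E) x}
    (he : IsOrthonormalAt g.inner x e) (v : TangentSpace 𝓘(ℝ, E) x) :
    firstKoszulForm nabla g.inner x v
      = ∑ i, g.inner x (differenceTensor nabla g.inner x v (e i)) (e i) := by
  rw [firstKoszulForm_eq_sum nabla g he]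
  exact Finset.sum_congr rfl fun i _ ↦ by rw [differenceTensor_swap g htorsion]

omit [FiniteDimensional ℝ E] in
lemma isLinearMap_firstKoszulForm (x : M) : IsLinearMap ℝ (firstKoszulForm nabla g.inner x) :=
  (g.inner x _).isLinear

omit [FiniteDimensional ℝ E] in
lemma isLinearMap_adjointKoszulForm (x : M) : IsLinearMap ℝ (adjointKoszulForm nabla g.inner x) :=
  (g.inner x _).isLinear

/-! ### The Koszul forms in a smooth orthonormal frame -/

variable {nabla} {f : Fin (Module.finrank ℝ E) → Π x : M, TangentSpace 𝓘(ℝ, E) x} {x : M}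
  (hf : ∀ i, IsSmoothNear (f i) x) (ho : ∀ᶠ y in 𝓝 x, IsOrthonormalAt g.inner y (fun i ↦ f i y))

omit [FiniteDimensional ℝ E] in
lemma IsSmoothNear.metric {V W : Π x : M, TangentSpace 𝓘(ℝ, E) x} (hV : IsSmoothNear V x)
    (hW : IsSmoothNear W x) : ∀ᶠ y in 𝓝 x, CMDiffAt ∞ (fun y ↦ g.inner y (V y) (W y)) y := by
  filter_upwards [hV, hW] with y h1 h2 using contMDiffAt_metric g h1 h2

include hf ho in
/-- As the frame is orthonormal, the first Koszul form is minus the trace of the connection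
matrix of `∇`. -/
lemma firstKoszulForm_eq_neg_sum (htorsion : nabla.torsion = 0) :
    ∀ᶠ y in 𝓝 x, ∀ v : TangentSpace 𝓘(ℝ, E) y,
      firstKoszulForm nabla g.inner y v = -∑ i, g.inner y (nabla (f i) y v) (f i y) := by
  have hf' : ∀ᶠ y in 𝓝 x, ∀ i, MDiffAt (T% (f i)) y :=
    Filter.eventually_all.2 fun i ↦ (hf i).eventually.mono fun y hy ↦ hy.mdifferentiableAt
  filter_upwards [hf', eventually_eventually_nhds.2 ho] with y h1 h2 v
  rw [firstKoszulForm_eq_sum_of_torsion_eq_zero g htorsion h2.self_of_nhds,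
    ← Finset.sum_neg_distrib]
  refine Finset.sum_congr rfl fun i _ ↦ ?_
  rw [differenceTensor_eq nabla g (h1 i), map_sub, sub_apply, sub_eq_neg_self]
  have h3 := (isLeviCivita_metric g).metric (mdifferentiableAt_extend 𝓘(ℝ, E) E v) (h1 i) (h1 i)
  -- `f i` has constant length near `y`
  have h4 : mvfderiv 𝓘(ℝ, E) (fun y ↦ g.inner y (f i y) (f i y)) y = 0 := by
    rw [mvfderiv_congr (f' := fun _ ↦ (1 : ℝ)) (h2.mono fun z hz ↦ by simpa using hz i i),
      mvfderiv_const]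
  rw [h4, extend_apply_self, g.symm y (f i y)] at h3
  have h5 : (0 : ℝ) = _ := h3
  linarith

omit [FiniteDimensional ℝ E] hf ho in
/-- The Leibniz rule for a linear combination of vector fields. -/
lemma covariantDerivative_sum_smul {ι : Type*} (s : Finset ι) {c : ι → M → ℝ}
    {V : ι → Π x : M, TangentSpace 𝓘(ℝ, E) x} (hc : ∀ i ∈ s, MDiffAt (c i) x)
    (hV : ∀ i ∈ s, MDiffAt (T% (V i)) x) (v : TangentSpace 𝓘(ℝ, E) x) :
    nabla (fun y ↦ ∑ i ∈ s, c i y • V i y) x v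
      = ∑ i ∈ s, (mvfderiv 𝓘(ℝ, E) (c i) x v • V i x + c i x • nabla (V i) x v) := by
  classical
  induction s using Finset.induction_on with
  | empty =>
    simp only [Finset.sum_empty]
    exact DFunLike.congr_fun (congrFun nabla.zero x) v
  | insert a s ha ih =>
    have hc' : ∀ i ∈ s, MDiffAt (c i) x := fun i hi ↦ hc i (Finset.mem_insert_of_mem hi)
    have hV' : ∀ i ∈ s, MDiffAt (T% (V i)) x := fun i hi ↦ hV i (Finset.mem_insert_of_mem hi)
    have hca := hc a (Finset.mem_insert_self _ _)
    have hVa := hV a (Finset.mem_insert_self _ _)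
    simp only [Finset.sum_insert ha]
    rw [← ih hc' hV']
    refine (DFunLike.congr_fun (nabla.isCovariantDerivativeOnUniv.add (hca.smul_section hVa)
      (.sum_section fun i hi ↦ (hc' i hi).smul_section (hV' i hi))) v).trans ?_
    refine congrArg (· + nabla (fun y ↦ ∑ i ∈ s, c i y • V i y) x v) ?_
    refine (DFunLike.congr_fun (nabla.isCovariantDerivativeOnUniv.leibniz hVa hca) v).trans ?_
    rw [add_comm]
    rfl

include hf ho in
/-- The covariant derivative of a field, through its components in an orthonormal frame. -/
lemma covariantDerivative_eq_sum_frame {W : Π x : M, TangentSpace 𝓘(ℝ, E) x}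
    (hW : IsSmoothNear W x) (v : TangentSpace 𝓘(ℝ, E) x) :
    nabla W x v = ∑ j, (mvfderiv 𝓘(ℝ, E) (fun y ↦ g.inner y (W y) (f j y)) x v • f j x
      + g.inner x (W x) (f j x) • nabla (f j) x v) := by
  rw [(covariantDerivative_congr (nabla := nabla) hW
    (W := fun y ↦ ∑ j, g.inner y (W y) (f j y) • f j y)
    (ho.mono fun y hy ↦ (sum_isOrthonormalAt hy _).symm)).self_of_nhds]
  exact covariantDerivative_sum_smul _
    (fun j _ ↦ (hW.metric g (hf j)).self_of_nhds.mdifferentiableAt (by simp))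
    (fun j _ ↦ (hf j).mdifferentiableAt) v

end Koszul

/-! ### Derivatives of the Koszul forms -/

section KoszulDerivative

variable {E : Type*} [NormedAddCommGroup E] [NormedSpace ℝ E] [FiniteDimensional ℝ E]
  {M : Type*} [TopologicalSpace M] [T2Space M] [ChartedSpace E M] [IsManifold 𝓘(ℝ, E) ∞ M]
  {nabla : CovariantDerivative 𝓘(ℝ, E) E (TangentSpace 𝓘(ℝ, E) : M → Type _)}
  (hsmooth : nabla.ContMDiffCovariantDerivative ∞) (htorsion : nabla.torsion = 0)
  (g : ContMDiffRiemannianMetric 𝓘(ℝ, E) ∞ E (TangentSpace 𝓘(ℝ, E) : M → Type _))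

include hsmooth htorsion

lemma IsSmoothNear.mlieBracket {V W : Π x : M, TangentSpace 𝓘(ℝ, E) x} {x : M}
    (hV : IsSmoothNear V x) (hW : IsSmoothNear W x) :
    IsSmoothNear (VectorField.mlieBracket 𝓘(ℝ, E) V W) x := by
  refine ((hW.covariantDerivative hsmooth hV).sub (hV.covariantDerivative hsmooth hW)).congr ?_
  filter_upwards [hV.eventually, hW.eventually] with y h1 h2
  exact nabla.torsion_eq_zero_iff.1 htorsion h1.mdifferentiableAt h2.mdifferentiableAt

lemma isDifferentiableOneFormAt_firstKoszulForm (x : M) :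
    IsDifferentiableOneFormAt (firstKoszulForm nabla g.inner) x := by
  obtain ⟨f, -, hf, ho⟩ := exists_orthonormalFrame g (isOrthonormalAt_metric g x)
  refine isDifferentiableOneFormAt_of_extend (isLinearMap_firstKoszulForm nabla g) fun v ↦ ?_
  have h : ∀ i, MDiffAt (fun y ↦ g.inner y (nabla (f i) y (extend E v y)) (f i y)) x := fun i ↦
    mdifferentiableAt_metric g
      ((hf i).covariantDerivative hsmooth (isSmoothNear_extend v)).mdifferentiableAt
      (hf i).mdifferentiableAt
  refine MDifferentiableAt.congr_of_eventuallyEq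
    (mdifferentiableAt_fun_sum Finset.univ fun i _ ↦ h i).1.neg ?_
  filter_upwards [firstKoszulForm_eq_neg_sum g hf ho htorsion] with y hy
  exact hy _

/-- In an orthonormal frame `f`, metricity and torsion freeness of the Levi-Civita connection `D`
give `⟨D_f f, Z⟩ = f⟨f, Z⟩ - ⟨f, [f, Z]⟩`; the first term is the component along `f` of
`∇_f (⟨f, Z⟩ f) - ⟨f, Z⟩ ∇_f f`. -/
lemma isDifferentiableOneFormAt_adjointKoszulForm (x : M) :
    IsDifferentiableOneFormAt (adjointKoszulForm nabla g.inner) x := by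
  obtain ⟨f, -, hf, ho⟩ := exists_orthonormalFrame g (isOrthonormalAt_metric g x)
  refine isDifferentiableOneFormAt_of_extend (isLinearMap_adjointKoszulForm nabla g) fun v ↦ ?_
  let Z : Π x : M, TangentSpace 𝓘(ℝ, E) x := extend E v
  have hZ : IsSmoothNear Z x := isSmoothNear_extend v
  have hc (i) := (hf i).metric g hZ
  have hcf (i) : IsSmoothNear (fun y ↦ g.inner y (f i y) (Z y) • f i y) x := (hf i).smul (hc i)
  have h1 (i) : MDiffAt (fun y ↦
      g.inner y (nabla (fun y ↦ g.inner y (f i y) (Z y) • f i y) y (f i y)) (f i y)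
      - g.inner y (f i y) (Z y) * g.inner y (nabla (f i) y (f i y)) (f i y)
      - g.inner y (f i y) (VectorField.mlieBracket 𝓘(ℝ, E) (f i) Z y)
      - g.inner y (nabla (f i) y (f i y)) (Z y)) x := by
    have hd := (hf i).mdifferentiableAt
    have hn := ((hf i).covariantDerivative hsmooth (hf i)).mdifferentiableAt
    refine (((mdifferentiableAt_metric g
      ((hcf i).covariantDerivative hsmooth (hf i)).mdifferentiableAt hd).sub ?_).sub
      (mdifferentiableAt_metric g hd
        ((hf i).mlieBracket hsmooth htorsion hZ).mdifferentiableAt)).sub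
      (mdifferentiableAt_metric g hn hZ.mdifferentiableAt)
    exact (mdifferentiableAt_metric g hd hZ.mdifferentiableAt).mul
      (mdifferentiableAt_metric g hn hd)
  refine MDifferentiableAt.congr_of_eventuallyEq
    (mdifferentiableAt_fun_sum Finset.univ fun i _ ↦ h1 i).1 ?_
  have hf' : ∀ᶠ y in 𝓝 x, ∀ i, IsSmoothNear (f i) y :=
    Filter.eventually_all.2 fun i ↦ (hf i).eventually
  filter_upwards [hf', hZ.eventually, eventually_eventually_nhds.2 ho] with y hfy hZy hoy
  rw [adjointKoszulForm_eq_sum nabla g hoy.self_of_nhds]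
  refine Finset.sum_congr rfl fun i _ ↦ ?_
  have hfi := (hfy i).mdifferentiableAt
  have hZ' := hZy.mdifferentiableAt
  have h2 := (isLeviCivita_metric g).metric hfi hfi hZ'
  have h3 := (isLeviCivita_metric g).metric hZ' hfi hfi
  have h4 := (isLeviCivita_metric g).torsion_free hfi hZ'
  -- `f i` has constant length near `y`
  have h5 : mvfderiv 𝓘(ℝ, E) (fun y ↦ g.inner y (f i y) (f i y)) y = 0 := by
    rw [mvfderiv_congr (f' := fun _ ↦ (1 : ℝ)) (hoy.mono fun z hz ↦ by simpa using hz i i),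
      mvfderiv_const]
  have h6 := DFunLike.congr_fun (nabla.isCovariantDerivativeOnUniv.leibniz hfi
    (((hfy i).metric g hZy).self_of_nhds.mdifferentiableAt (by simp))) (f i y)
  have h7 : nabla (fun y ↦ g.inner y (f i y) (Z y) • f i y) y (f i y)
      = g.inner y (f i y) (Z y) • nabla (f i) y (f i y)
        + mvfderiv 𝓘(ℝ, E) (fun y ↦ g.inner y (f i y) (Z y)) y (f i y) • f i y := h6
  have h8 : g.inner y (f i y) (f i y) = 1 := by simpa using hoy.self_of_nhds i i
  have h9 : (0 : ℝ) = _ := (congrArg (fun L ↦ L (Z y)) h5).symm.trans h3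
  rw [differenceTensor_eq nabla g hfi, h7, ← h4, h2]
  rw [g.symm y (f i y) (leviCivita g.inner (f i) y (Z y))] at h9
  simp only [map_sub, sub_apply, map_add, add_apply, map_smul, smul_apply, smul_eq_mul, h8]
  rw [g.symm y (f i y) (leviCivita g.inner (f i) y (Z y))]
  linarith

/-- The first Koszul form is minus the trace of the connection matrix of `∇` in an orthonormal
frame, so its exterior derivative is minus the trace of the curvature of `∇`. -/
theorem isClosedOneForm_firstKoszulForm (hflat : IsFlat nabla) :
    IsClosedOneForm (firstKoszulForm nabla g.inner) := by
  intro x X₀ Y₀ hX₀ hY₀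
  obtain ⟨f, -, hf, ho⟩ := exists_orthonormalFrame g (isOrthonormalAt_metric g x)
  let X : Π x : M, TangentSpace 𝓘(ℝ, E) x := extend E (X₀ x)
  let Y : Π x : M, TangentSpace 𝓘(ℝ, E) x := extend E (Y₀ x)
  have hX : IsSmoothNear X x := isSmoothNear_extend _
  have hY : IsSmoothNear Y x := isSmoothNear_extend _
  rw [extDerivOneForm_eq_of_eq (isDifferentiableOneFormAt_firstKoszulForm hsmooth htorsion g x)
    hX₀ hX.mdifferentiableAt hY₀ hY.mdifferentiableAt (extend_apply_self _ _).symm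
    (extend_apply_self _ _).symm]
  have hα := firstKoszulForm_eq_neg_sum g hf ho htorsion
  have hderiv {W : Π x : M, TangentSpace 𝓘(ℝ, E) x} (hW : IsSmoothNear W x)
      (v : TangentSpace 𝓘(ℝ, E) x) :
      mvfderiv 𝓘(ℝ, E) (fun y ↦ firstKoszulForm nabla g.inner y (W y)) x v
        = -∑ i, g.inner x (nabla (fun y ↦ nabla (f i) y (W y)) x v) (f i x)
          + ∑ i, ∑ j, g.inner x (nabla (f i) x (W x)) (f j x)
            * g.inner x (nabla (f j) x v) (f i x) := by
    have hn (i) : IsSmoothNear (fun y ↦ nabla (f i) y (W y)) x :=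
      (hf i).covariantDerivative hsmooth hW
    have hs := mdifferentiableAt_fun_sum Finset.univ
      (f := fun i y ↦ g.inner y (nabla (f i) y (W y)) (f i y)) fun i _ ↦
        mdifferentiableAt_metric g (hn i).mdifferentiableAt (hf i).mdifferentiableAt
    rw [mvfderiv_congr (hα.mono fun y hy ↦ hy (W y)), mvfderiv_fun_neg, hs.2, neg_apply, sum_apply,
      ← sub_eq_neg_add, ← sub_eq_zero, ← neg_eq_zero]
    -- the derivative of the components of `∇_W f i` in the frame
    have key (i) : g.inner x (nabla (fun y ↦ nabla (f i) y (W y)) x v) (f i x)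
        = mvfderiv 𝓘(ℝ, E) (fun y ↦ g.inner y (nabla (f i) y (W y)) (f i y)) x v
          + ∑ j, g.inner x (nabla (f i) x (W x)) (f j x)
            * g.inner x (nabla (f j) x v) (f i x) := by
      have h := ho.self_of_nhds
      rw [covariantDerivative_eq_sum_frame g hf ho (hn i) v, Finset.sum_add_distrib, map_add,
        add_apply, map_sum, map_sum, sum_apply, sum_apply]
      congr 1
      · rw [Finset.sum_eq_single i]
        · rw [map_smul, smul_apply, h, if_pos rfl, smul_eq_mul, mul_one]
        · intro j _ hj
          rw [map_smul, smul_apply, h, if_neg hj, smul_zero]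
        · simp
      · exact Finset.sum_congr rfl fun j _ ↦ by rw [map_smul, smul_apply, smul_eq_mul]
    simp only [key, Finset.sum_add_distrib]
    ring
  have hflat' (i) := hflat.curvature_eq_zero hsmooth hX hY (hf i)
  have hsum : ∑ i, g.inner x (nabla (fun y ↦ nabla (f i) y (Y y)) x (X x)) (f i x)
      - ∑ i, g.inner x (nabla (fun y ↦ nabla (f i) y (X y)) x (Y x)) (f i x)
      - ∑ i, g.inner x (nabla (f i) x (VectorField.mlieBracket 𝓘(ℝ, E) X Y x)) (f i x) = 0 := by
    rw [← Finset.sum_sub_distrib, ← Finset.sum_sub_distrib]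
    refine Finset.sum_eq_zero fun i _ ↦ ?_
    rw [← sub_apply, ← sub_apply, ← map_sub, ← map_sub, hflat' i, map_zero, zero_apply]
  -- the term `A ∧ A` of the curvature, `A` the connection matrix, has trace zero
  have hcomm : ∑ i, ∑ j, g.inner x (nabla (f i) x (Y x)) (f j x)
        * g.inner x (nabla (f j) x (X x)) (f i x)
      = ∑ i, ∑ j, g.inner x (nabla (f i) x (X x)) (f j x)
        * g.inner x (nabla (f j) x (Y x)) (f i x) := by
    rw [Finset.sum_comm]
    exact Finset.sum_congr rfl fun i _ ↦ Finset.sum_congr rfl fun j _ ↦ mul_comm _ _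
  rw [extDerivOneForm, hderiv hX, hderiv hY, hα.self_of_nhds, hcomm]
  linarith

end KoszulDerivative

/-! ### Differentiable vector fields on the tangent bundle -/

section AlongProjection

variable {E : Type*} [NormedAddCommGroup E] [NormedSpace ℝ E]
  {M : Type*} [TopologicalSpace M] [ChartedSpace E M] [IsManifold 𝓘(ℝ, E) ∞ M]

/-- The field `D` of tangent vectors of `M` along the projection `TM → M` is differentiable at
`p`. -/
def IsDifferentiableAlongAt (D : Π q : TangentBundle 𝓘(ℝ, E) M, TangentSpace 𝓘(ℝ, E) q.1)
    (p : TangentBundle 𝓘(ℝ, E) M) : Prop :=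
  MDifferentiableAt 𝓘(ℝ, E).tangent 𝓘(ℝ, E).tangent
    (fun q ↦ (⟨q.1, D q⟩ : TangentBundle 𝓘(ℝ, E) M)) p

variable {D Q : Π q : TangentBundle 𝓘(ℝ, E) M, TangentSpace 𝓘(ℝ, E) q.1}
  {p : TangentBundle 𝓘(ℝ, E) M}

lemma mdifferentiableAt_proj_tangentBundle (p : TangentBundle 𝓘(ℝ, E) M) :
    MDifferentiableAt 𝓘(ℝ, E).tangent 𝓘(ℝ, E) (fun q : TangentBundle 𝓘(ℝ, E) M ↦ q.1) p :=
  mdifferentiableAt_proj (TangentSpace 𝓘(ℝ, E) : M → Type _)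

lemma isDifferentiableAlongAt_iff : IsDifferentiableAlongAt D p ↔
    MDifferentiableAt 𝓘(ℝ, E).tangent 𝓘(ℝ, E) (fun q ↦ tangentCoord 𝓘(ℝ, E) p.1 q.1 (D q)) p := by
  have e : (fun q ↦ tangentCoord 𝓘(ℝ, E) p.1 q.1 (D q))
      = fun q ↦ (trivializationAt E (TangentSpace 𝓘(ℝ, E)) p.1 ⟨q.1, D q⟩).2 :=
    funext fun q ↦ tangentCoord_eq_trivializationAt _ _ _
  rw [e]
  refine Iff.trans (mdifferentiableAt_totalSpace 𝓘(ℝ, E)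
    (fun q : TangentBundle 𝓘(ℝ, E) M ↦ (⟨q.1, D q⟩ : TangentBundle 𝓘(ℝ, E) M))) ?_
  exact and_iff_right (mdifferentiableAt_proj_tangentBundle p)

/-- The tautological field `(x, u) ↦ u` is differentiable. -/
lemma isDifferentiableAlongAt_snd : IsDifferentiableAlongAt (fun q ↦ q.2) p :=
  mdifferentiableAt_id

lemma isDifferentiableAlongAt_comp_proj {X : Π x : M, TangentSpace 𝓘(ℝ, E) x}
    (hX : MDiffAt (T% X) p.1) : IsDifferentiableAlongAt (fun q ↦ X q.1) p :=
  MDifferentiableAt.comp (g := T% X) p hX (mdifferentiableAt_proj_tangentBundle p)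

lemma isDifferentiableAlongAt_zero : IsDifferentiableAlongAt (fun _ ↦ 0) p := by
  rw [isDifferentiableAlongAt_iff]
  simpa using mdifferentiableAt_const

lemma IsDifferentiableAlongAt.neg (hD : IsDifferentiableAlongAt D p) :
    IsDifferentiableAlongAt (fun q ↦ -D q) p := by
  rw [isDifferentiableAlongAt_iff] at hD ⊢
  simp only [map_neg]
  exact hD.neg

variable [FiniteDimensional ℝ E] [T2Space M]
  {nabla : CovariantDerivative 𝓘(ℝ, E) E (TangentSpace 𝓘(ℝ, E) : M → Type _)}
  (hsmooth : nabla.ContMDiffCovariantDerivative ∞)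
include hsmooth

/-- The Christoffel term of the horizontal lift is differentiable. -/
lemma mdifferentiableAt_christoffel (hD : IsDifferentiableAlongAt D p) :
    MDifferentiableAt 𝓘(ℝ, E).tangent 𝓘(ℝ, E) (fun q ↦ tangentCoord 𝓘(ℝ, E) p.1 q.1
      (nabla (extend E (modelEquiv 𝓘(ℝ, E) p.1 (tangentCoord 𝓘(ℝ, E) p.1 q.1 q.2)))
        q.1 (D q))) p := by
  let b := Module.finBasis ℝ (TangentSpace 𝓘(ℝ, E) p.1)
  let z (q : TangentBundle 𝓘(ℝ, E) M) : TangentSpace 𝓘(ℝ, E) p.1 :=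
    modelEquiv 𝓘(ℝ, E) p.1 (tangentCoord 𝓘(ℝ, E) p.1 q.1 q.2)
  have hz (k) : MDifferentiableAt 𝓘(ℝ, E).tangent 𝓘(ℝ) (fun q ↦ b.repr (z q) k) p := by
    let L : E →L[ℝ] ℝ := ((b.coord k).toContinuousLinearMap).comp
      (modelEquiv 𝓘(ℝ, E) p.1).toContinuousLinearMap
    exact L.mdifferentiableAt.comp (I' := 𝓘(ℝ, E)) p
      (isDifferentiableAlongAt_iff.1 isDifferentiableAlongAt_snd)
  have hb (k) : IsDifferentiableAlongAt (fun q ↦ nabla (extend E (b k)) q.1 (D q)) p := by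
    obtain ⟨W, hW, hW'⟩ := (isSmoothNear_extend (b k)).exists_contMDiff
    have h1 := contMDiffOn_univ.1 (hsmooth.contMDiff.contMDiff (σ := W) (contMDiffOn_univ.2 hW))
    have h2 := MDifferentiableAt.comp p ((h1 p.1).mdifferentiableAt (by simp))
      (mdifferentiableAt_proj_tangentBundle p)
    have h3 := MDifferentiableAt.clm_bundle_apply (b := fun q : TangentBundle 𝓘(ℝ, E) M ↦ q.1)
      (F₁ := E) (F₂ := E) h2 hD
    refine h3.congr_of_eventuallyEq ?_
    have h4 := covariantDerivative_congr (nabla := nabla) (isSmoothNear_extend (b k)) hW'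
    filter_upwards [(mdifferentiableAt_proj_tangentBundle p).continuousAt.eventually h4] with q hq
    rw [hq]
  have hsum := (mdifferentiableAt_fun_sum (I := 𝓘(ℝ, E).tangent) (x := p) Finset.univ fun k _ ↦
    (hz k).smul (isDifferentiableAlongAt_iff.1 (hb k))).1
  refine hsum.congr_of_eventuallyEq ?_
  have hs : ∀ᶠ y in 𝓝 p.1, ∀ k, IsSmoothNear (extend E (b k)) y :=
    Filter.eventually_all.2 fun k ↦ (isSmoothNear_extend (b k)).eventually
  have hproj := (mdifferentiableAt_proj_tangentBundle p).continuousAt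
  filter_upwards [hproj.eventually hs, eventually_proj_mem_chart_source p] with q h1 h2
  have h3 : ∀ᶠ y in 𝓝 q.1, ∑ k, b.repr (z q) k • (extend E (b k) y : TangentSpace 𝓘(ℝ, E) y)
      = extend E (z q) y := by
    filter_upwards [(chartAt E p.1).open_source.mem_nhds h2] with y hy
    rw [← extend_sum_smul hy, b.sum_repr]
  have h4 : IsSmoothNear (fun y ↦ ∑ k, b.repr (z q) k • (extend E (b k) y : TangentSpace 𝓘(ℝ, E) y))
      q.1 := isSmoothNear_sum _ fun k _ ↦ (h1 k).smul (.of_forall fun _ ↦ contMDiffAt_const)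
  rw [← (covariantDerivative_congr (nabla := nabla) h4 h3).self_of_nhds,
    covariantDerivative_sum_smul _ (fun k _ ↦ mdifferentiableAt_const)
      fun k _ ↦ (h1 k).mdifferentiableAt, map_sum]
  refine Finset.sum_congr rfl fun k _ ↦ ?_
  rw [mvfderiv_const, zero_apply, zero_smul, zero_add, map_smul]
  rfl

/-- A vector field on `TM` is differentiable if and only if its two components are. -/
lemma mdifferentiableAt_tangentBundle_iff {W : Π q, TangentSpace 𝓘(ℝ, E).tangent q} :
    MDifferentiableAt 𝓘(ℝ, E).tangent 𝓘(ℝ, E).tangent.tangent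
      (fun q ↦ (⟨q, W q⟩ : TangentBundle 𝓘(ℝ, E).tangent (TangentBundle 𝓘(ℝ, E) M))) p ↔
    IsDifferentiableAlongAt (fun q ↦ dproj q (W q)) p ∧
      IsDifferentiableAlongAt (fun q ↦ connectionMap nabla q (W q)) p := by
  have h1 : ∀ᶠ q in 𝓝 p, tangentCoord 𝓘(ℝ, E).tangent p q (W q)
      = (tangentCoord 𝓘(ℝ, E) p.1 q.1 (dproj q (W q)),
        tangentCoord 𝓘(ℝ, E) p.1 q.1 (connectionMap nabla q (W q)) - tangentCoord 𝓘(ℝ, E) p.1 q.1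
          (nabla (extend E (modelEquiv 𝓘(ℝ, E) p.1 (tangentCoord 𝓘(ℝ, E) p.1 q.1 q.2))) q.1
            (dproj q (W q)))) := by
    filter_upwards [eventually_proj_mem_chart_source p] with q hq
    conv_lhs => rw [← horizontalLift_add_verticalLift nabla q (W q)]
    rw [map_add, tangentCoord_horizontalLift nabla hq, tangentCoord_verticalLift hq]
    refine Prod.ext (add_zero _) ?_
    exact neg_add_eq_sub _ _
  refine (mdifferentiableAt_tangentCoord (I := 𝓘(ℝ, E).tangent)).trans ?_
  refine Iff.trans (Filter.EventuallyEq.mdifferentiableAt_iff (I := 𝓘(ℝ, E).tangent)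
    (I' := 𝓘(ℝ, E × E)) h1) ?_
  constructor
  · intro h
    have hD : IsDifferentiableAlongAt (fun q ↦ dproj q (W q)) p :=
      isDifferentiableAlongAt_iff.2 ((ContinuousLinearMap.fst ℝ E E).mdifferentiableAt.comp p h)
    refine ⟨hD, isDifferentiableAlongAt_iff.2 ?_⟩
    have h2 := ((ContinuousLinearMap.snd ℝ E E).mdifferentiableAt.comp p h).add
      (mdifferentiableAt_christoffel hsmooth hD)
    refine h2.congr_of_eventuallyEq (.of_forall fun q ↦ ?_)
    exact (sub_add_cancel _ _).symm
  · rintro ⟨hD, hQ⟩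
    exact (isDifferentiableAlongAt_iff.1 hD).prodMk_space
      ((isDifferentiableAlongAt_iff.1 hQ).sub (mdifferentiableAt_christoffel hsmooth hD))

end AlongProjection

/-! ### The Hermitian structure of the tangent bundle -/

section HermitianStructure

variable {E : Type*} [NormedAddCommGroup E] [NormedSpace ℝ E]
  {M : Type*} [TopologicalSpace M] [ChartedSpace E M] [IsManifold 𝓘(ℝ, E) ∞ M]
  (nabla : CovariantDerivative 𝓘(ℝ, E) E (TangentSpace 𝓘(ℝ, E) : M → Type _))
  (g : ContMDiffRiemannianMetric 𝓘(ℝ, E) ∞ E (TangentSpace 𝓘(ℝ, E) : M → Type _))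
  {p : TangentBundle 𝓘(ℝ, E) M} (V W : TangentSpace 𝓘(ℝ, E).tangent p)

lemma complexStructure_apply : complexStructure nabla p V
    = verticalLift p (dproj p V) - horizontalLift nabla p (connectionMap nabla p V) := rfl

@[simp] lemma dproj_complexStructure :
    dproj p (complexStructure nabla p V) = -connectionMap nabla p V := by
  simp [complexStructure_apply]

@[simp] lemma connectionMap_complexStructure :
    connectionMap nabla p (complexStructure nabla p V) = dproj p V := by
  simp [complexStructure_apply]

lemma complexStructure_complexStructure :
    complexStructure nabla p (complexStructure nabla p V) = -V := by
  apply ext_dproj_connectionMap nabla <;> simp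

lemma complexStructure_horizontalLift (v : TangentSpace 𝓘(ℝ, E) p.1) :
    complexStructure nabla p (horizontalLift nabla p v) = verticalLift p v := by
  apply ext_dproj_connectionMap nabla <;> simp

lemma tangentMetric_apply : tangentMetric nabla g.inner p V W
    = g.inner p.1 (dproj p V) (dproj p W)
      + g.inner p.1 (connectionMap nabla p V) (connectionMap nabla p W) := rfl

lemma tangentMetric_complexStructure :
    tangentMetric nabla g.inner p (complexStructure nabla p V) (complexStructure nabla p W)
      = tangentMetric nabla g.inner p V W := by
  simp [tangentMetric_apply, add_comm]

lemma tangentMetric_swap :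
    tangentMetric nabla g.inner p V W = tangentMetric nabla g.inner p W V := by
  rw [tangentMetric_apply, tangentMetric_apply, g.symm _ (dproj p V),
    g.symm _ (connectionMap nabla p V)]

lemma tangentMetric_pos (hV : V ≠ 0) : 0 < tangentMetric nabla g.inner p V V := by
  have hnn (x : M) (v : TangentSpace 𝓘(ℝ, E) x) : 0 ≤ g.inner x v v := by
    rcases eq_or_ne v 0 with rfl | h
    · simp
    · exact (g.pos x v h).le
  rw [tangentMetric_apply]
  by_cases h : dproj p V = 0
  · have h' : connectionMap nabla p V ≠ 0 := fun h' ↦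
      hV (ext_dproj_connectionMap nabla (by simpa using h) (by simpa using h'))
    exact add_pos_of_nonneg_of_pos (hnn _ _) (g.pos _ _ h')
  · exact add_pos_of_pos_of_nonneg (g.pos _ _ h) (hnn _ _)

lemma fundamentalForm_tangentMetric :
    fundamentalForm (complexStructure nabla) (tangentMetric nabla g.inner) p V W
      = g.inner p.1 (dproj p V) (connectionMap nabla p W)
        - g.inner p.1 (connectionMap nabla p V) (dproj p W) := by
  rw [fundamentalForm_apply, tangentMetric_apply, dproj_complexStructure,
    connectionMap_complexStructure, map_neg, neg_apply]
  ring

variable [FiniteDimensional ℝ E] [T2Space M] {nabla}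
  (hsmooth : nabla.ContMDiffCovariantDerivative ∞)
include hsmooth

lemma isDifferentiableBilinAt_tangentMetric (p : TangentBundle 𝓘(ℝ, E) M) :
    IsDifferentiableBilinAt (tangentMetric nabla g.inner) p := by
  intro V W hV hW
  obtain ⟨hV1, hV2⟩ := (mdifferentiableAt_tangentBundle_iff hsmooth).1 hV
  obtain ⟨hW1, hW2⟩ := (mdifferentiableAt_tangentBundle_iff hsmooth).1 hW
  exact (mdifferentiableAt_metric g hV1 hW1).add (mdifferentiableAt_metric g hV2 hW2)

lemma isDifferentiableBilinAt_fundamentalForm (p : TangentBundle 𝓘(ℝ, E) M) :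
    IsDifferentiableBilinAt
      (fundamentalForm (complexStructure nabla) (tangentMetric nabla g.inner)) p := by
  intro V W hV hW
  obtain ⟨hV1, hV2⟩ := (mdifferentiableAt_tangentBundle_iff hsmooth).1 hV
  obtain ⟨hW1, hW2⟩ := (mdifferentiableAt_tangentBundle_iff hsmooth).1 hW
  simp only [fundamentalForm_tangentMetric]
  exact (mdifferentiableAt_metric g hV1 hW2).sub (mdifferentiableAt_metric g hV2 hW1)

lemma mdifferentiableAt_complexStructure {V : Π q, TangentSpace 𝓘(ℝ, E).tangent q}
    {p : TangentBundle 𝓘(ℝ, E) M} (hV : MDifferentiableAt 𝓘(ℝ, E).tangent 𝓘(ℝ, E).tangent.tangent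
      (fun q ↦ (⟨q, V q⟩ : TangentBundle 𝓘(ℝ, E).tangent (TangentBundle 𝓘(ℝ, E) M))) p) :
    MDifferentiableAt 𝓘(ℝ, E).tangent 𝓘(ℝ, E).tangent.tangent
      (fun q ↦ (⟨q, complexStructure nabla q (V q)⟩ :
        TangentBundle 𝓘(ℝ, E).tangent (TangentBundle 𝓘(ℝ, E) M))) p := by
  rw [mdifferentiableAt_tangentBundle_iff hsmooth] at hV ⊢
  simp only [dproj_complexStructure, connectionMap_complexStructure]
  exact ⟨hV.2.neg, hV.1⟩

variable {X : Π x : M, TangentSpace 𝓘(ℝ, E) x} (hX : MDiffAt (T% X) p.1)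
include hX

lemma mdifferentiableAt_horizontalLift :
    MDifferentiableAt 𝓘(ℝ, E).tangent 𝓘(ℝ, E).tangent.tangent
      (fun q ↦ (⟨q, horizontalLift nabla q (X q.1)⟩ :
        TangentBundle 𝓘(ℝ, E).tangent (TangentBundle 𝓘(ℝ, E) M))) p := by
  rw [mdifferentiableAt_tangentBundle_iff hsmooth]
  simp only [dproj_horizontalLift, connectionMap_horizontalLift]
  exact ⟨isDifferentiableAlongAt_comp_proj hX, isDifferentiableAlongAt_zero⟩

lemma mdifferentiableAt_verticalLift :
    MDifferentiableAt 𝓘(ℝ, E).tangent 𝓘(ℝ, E).tangent.tangent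
      (fun q ↦ (⟨q, verticalLift q (X q.1)⟩ :
        TangentBundle 𝓘(ℝ, E).tangent (TangentBundle 𝓘(ℝ, E) M))) p := by
  rw [mdifferentiableAt_tangentBundle_iff hsmooth]
  simp only [dproj_verticalLift, connectionMap_verticalLift]
  exact ⟨isDifferentiableAlongAt_zero, isDifferentiableAlongAt_comp_proj hX⟩

end HermitianStructure

/-! ### Lie brackets of lifts -/

section Brackets

variable {E : Type*} [NormedAddCommGroup E] [NormedSpace ℝ E]
  {M : Type*} [TopologicalSpace M] [ChartedSpace E M] [IsManifold 𝓘(ℝ, E) ∞ M]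
  {p : TangentBundle 𝓘(ℝ, E) M}

lemma mvfderiv_comp_proj {G : Type*} [NormedAddCommGroup G] [NormedSpace ℝ G] {f : M → G}
    (hf : MDiffAt f p.1) (V : TangentSpace 𝓘(ℝ, E).tangent p) :
    mvfderiv 𝓘(ℝ, E).tangent (fun q : TangentBundle 𝓘(ℝ, E) M ↦ f q.1) p V
      = mvfderiv 𝓘(ℝ, E) f p.1 (dproj p V) :=
  mfderiv_comp_apply p hf (mdifferentiableAt_proj_tangentBundle p) V

/-- The differential along the fibre is the differential of the restriction to the fibre. -/
lemma mvfderiv_verticalLift {G : Type*} [NormedAddCommGroup G] [NormedSpace ℝ G]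
    {f : TangentBundle 𝓘(ℝ, E) M → G} {y : M} {z w : E} (hf : MDiffAt f (fibreInclusion y z)) :
    mvfderiv 𝓘(ℝ, E).tangent f (fibreInclusion y z)
        (verticalLift (fibreInclusion y z) (modelEquiv 𝓘(ℝ, E) y w))
      = fderiv ℝ (f ∘ fibreInclusion y) z w := by
  rw [← mfderiv_fibreInclusion, ← mfderiv_eq_fderiv]
  exact (mfderiv_comp_apply z hf (mdifferentiableAt_fibreInclusion y z) _).symm

variable {V : Π q, TangentSpace 𝓘(ℝ, E).tangent q}
  (hV : MDifferentiableAt 𝓘(ℝ, E).tangent 𝓘(ℝ, E).tangent.tangent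
      (fun q ↦ (⟨q, V q⟩ : TangentBundle 𝓘(ℝ, E).tangent (TangentBundle 𝓘(ℝ, E) M))) p)
include hV

/-- The chart derivative of a vector field on `TM` that projects to `M`. -/
lemma dproj_chartDeriv {X : Π x : M, TangentSpace 𝓘(ℝ, E) x} (hX : MDiffAt (T% X) p.1)
    (h : ∀ q, dproj q (V q) = X q.1) (W : TangentSpace 𝓘(ℝ, E).tangent p) :
    dproj p (chartDeriv V p W) = chartDeriv X p.1 (dproj p W) := by
  have hV' : MDifferentiableAt 𝓘(ℝ, E).tangent 𝓘(ℝ, E × E)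
    (fun q ↦ tangentCoord 𝓘(ℝ, E).tangent p q (V q)) p := mdifferentiableAt_tangentCoord.1 hV
  rw [dproj_apply, chartDeriv_apply, ContinuousLinearEquiv.symm_apply_apply, chartDeriv_apply]
  congr 1
  refine (mvfderiv_clm_comp (ContinuousLinearMap.fst ℝ E E) hV' W).symm.trans ?_
  rw [← mvfderiv_comp_proj (mdifferentiableAt_tangentCoord.1 hX)]
  refine DFunLike.congr_fun (mvfderiv_congr ?_) W
  filter_upwards [eventually_proj_mem_chart_source p] with q hq
  exact (fst_tangentCoord_tangentBundle hq _).trans (by rw [h])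

omit hV in
/-- The Lie bracket of projectable vector fields projects to the Lie bracket. -/
lemma dproj_mlieBracket [FiniteDimensional ℝ E] {V W : Π q, TangentSpace 𝓘(ℝ, E).tangent q}
    (hV : MDifferentiableAt 𝓘(ℝ, E).tangent 𝓘(ℝ, E).tangent.tangent
      (fun q ↦ (⟨q, V q⟩ : TangentBundle 𝓘(ℝ, E).tangent (TangentBundle 𝓘(ℝ, E) M))) p)
    (hW : MDifferentiableAt 𝓘(ℝ, E).tangent 𝓘(ℝ, E).tangent.tangent
      (fun q ↦ (⟨q, W q⟩ : TangentBundle 𝓘(ℝ, E).tangent (TangentBundle 𝓘(ℝ, E) M))) p)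
    {X Y : Π x : M, TangentSpace 𝓘(ℝ, E) x} (hX : MDiffAt (T% X) p.1) (hY : MDiffAt (T% Y) p.1)
    (hVX : ∀ q, dproj q (V q) = X q.1) (hWY : ∀ q, dproj q (W q) = Y q.1) :
    dproj p (VectorField.mlieBracket 𝓘(ℝ, E).tangent V W p)
      = VectorField.mlieBracket 𝓘(ℝ, E) X Y p.1 := by
  rw [mlieBracket_eq_chartDeriv hV hW, mlieBracket_eq_chartDeriv hX hY, map_sub,
    dproj_chartDeriv hV hX hVX, dproj_chartDeriv hW hY hWY, hVX, hWY]

omit hV in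
/-- The chart derivative of a vertical lift. -/
lemma chartDeriv_verticalLift {X : Π x : M, TangentSpace 𝓘(ℝ, E) x} (hX : MDiffAt (T% X) p.1)
    (W : TangentSpace 𝓘(ℝ, E).tangent p) :
    chartDeriv (fun q ↦ verticalLift q (X q.1)) p W
      = verticalLift p (chartDeriv X p.1 (dproj p W)) := by
  rw [chartDeriv_apply, chartDeriv_apply, verticalLift_apply,
    ContinuousLinearEquiv.symm_apply_apply,
    ← mvfderiv_comp_proj (mdifferentiableAt_tangentCoord.1 hX)]
  congr 1
  have h1 : MDifferentiableAt 𝓘(ℝ, E).tangent 𝓘(ℝ, E)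
      (fun q : TangentBundle 𝓘(ℝ, E) M ↦ tangentCoord 𝓘(ℝ, E) p.1 q.1 (X q.1)) p :=
    isDifferentiableAlongAt_iff.1 (isDifferentiableAlongAt_comp_proj hX)
  refine Eq.trans ?_ (mvfderiv_clm_comp (ContinuousLinearMap.inr ℝ E E) h1 W)
  refine DFunLike.congr_fun (mvfderiv_congr ?_) W
  filter_upwards [eventually_proj_mem_chart_source p] with q hq
  exact tangentCoord_verticalLift hq _

variable [FiniteDimensional ℝ E] [T2Space M]
  {nabla : CovariantDerivative 𝓘(ℝ, E) E (TangentSpace 𝓘(ℝ, E) : M → Type _)}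
  (hsmooth : nabla.ContMDiffCovariantDerivative ∞)
include hsmooth
omit hV

/-- The horizontal lift depends linearly on the position in the fibre. -/
lemma chartDeriv_horizontalLift_verticalLift {X : Π x : M, TangentSpace 𝓘(ℝ, E) x}
    (hX : MDiffAt (T% X) p.1) (w : TangentSpace 𝓘(ℝ, E) p.1) :
    chartDeriv (fun q ↦ horizontalLift nabla q (X q.1)) p (verticalLift p w)
      = verticalLift p (-nabla (extend E w) p.1 (X p.1)) := by
  obtain ⟨x, u⟩ := p
  obtain ⟨z, rfl⟩ := (modelEquiv 𝓘(ℝ, E) x).surjective u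
  obtain ⟨w, rfl⟩ := (modelEquiv 𝓘(ℝ, E) x).surjective w
  change chartDeriv (fun q ↦ horizontalLift nabla q (X q.1)) (fibreInclusion x z)
    (verticalLift (fibreInclusion x z) (modelEquiv 𝓘(ℝ, E) x w)) = _
  have h1 := mdifferentiableAt_horizontalLift (p := fibreInclusion x z) hsmooth hX
  have h2 : MDifferentiableAt 𝓘(ℝ, E).tangent 𝓘(ℝ, E × E) _ _ := mdifferentiableAt_tangentCoord.1 h1
  -- the zero order part of the connection at `x`
  let A := nabla.isCovariantDerivativeOnUniv.difference
    (isCovariantDerivativeOn_chartDeriv (I := 𝓘(ℝ, E)) (N := M)) x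
  have hA (v : TangentSpace 𝓘(ℝ, E) x) : A v = nabla (extend E v) x := by
    have h := IsCovariantDerivativeOn.difference_apply nabla.isCovariantDerivativeOnUniv
      (isCovariantDerivativeOn_chartDeriv (I := 𝓘(ℝ, E)) (N := M)) (x := x) trivial
      (mdifferentiableAt_extend 𝓘(ℝ, E) E v)
    rw [extend_apply_self, chartDeriv_extend, sub_zero] at h
    exact h
  let L : E →L[ℝ] E := LinearMap.toContinuousLinearMap
    { toFun := fun s ↦ -(modelEquiv 𝓘(ℝ, E) x).symm (A (modelEquiv 𝓘(ℝ, E) x s) (X x))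
      map_add' := fun s t ↦ by simp only [map_add, add_apply, neg_add]
      map_smul' := fun c s ↦ by simp only [map_smul, smul_apply, smul_neg, RingHom.id_apply] }
  have h3 : (fun q ↦ tangentCoord 𝓘(ℝ, E).tangent (fibreInclusion x z) q
      (horizontalLift nabla q (X q.1))) ∘ fibreInclusion x
      = fun s ↦ ((modelEquiv 𝓘(ℝ, E) x).symm (X x), L s) := by
    funext s
    refine (tangentCoord_horizontalLift (p := fibreInclusion x z) (q := fibreInclusion x s) nabla
      (mem_chart_source E x) (X x)).trans (Prod.ext (tangentCoord_self x _) ?_)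
    have e : modelEquiv 𝓘(ℝ, E) x (tangentCoord 𝓘(ℝ, E) x x (modelEquiv 𝓘(ℝ, E) x s))
        = modelEquiv 𝓘(ℝ, E) x s := by
      rw [tangentCoord_self, ContinuousLinearEquiv.apply_symm_apply]
    change -tangentCoord 𝓘(ℝ, E) x x (nabla (extend E (modelEquiv 𝓘(ℝ, E) x
      (tangentCoord 𝓘(ℝ, E) x x (modelEquiv 𝓘(ℝ, E) x s)))) x (X x))
        = -(modelEquiv 𝓘(ℝ, E) x).symm (A (modelEquiv 𝓘(ℝ, E) x s) (X x))
    rw [e, tangentCoord_self, hA]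
  have h4 : fderiv ℝ (fun s : E ↦ ((modelEquiv 𝓘(ℝ, E) x).symm (X x), L s)) z w = (0, L w) := by
    have := (hasFDerivAt_const ((modelEquiv 𝓘(ℝ, E) x).symm (X x)) z).prodMk
      (L.hasFDerivAt (x := z))
    rw [this.fderiv]
    rfl
  have h5 := (mvfderiv_verticalLift (w := w) h2).trans ((congrArg (fderiv ℝ · z w) h3).trans h4)
  refine (congrArg (modelEquiv 𝓘(ℝ, E).tangent (fibreInclusion x z)) h5).trans ?_
  rw [← hA]
  rfl

/-- `[X^h, Y^v] = (∇_X Y)^v`. -/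
lemma mlieBracket_horizontalLift_verticalLift {X Y : Π x : M, TangentSpace 𝓘(ℝ, E) x}
    (hX : MDiffAt (T% X) p.1) (hY : MDiffAt (T% Y) p.1) :
    VectorField.mlieBracket 𝓘(ℝ, E).tangent (fun q ↦ horizontalLift nabla q (X q.1))
        (fun q ↦ verticalLift q (Y q.1)) p
      = verticalLift p (nabla Y p.1 (X p.1)) := by
  rw [mlieBracket_eq_chartDeriv (mdifferentiableAt_horizontalLift hsmooth hX)
    (mdifferentiableAt_verticalLift hsmooth hY), chartDeriv_verticalLift hY,
    chartDeriv_horizontalLift_verticalLift hsmooth hX, dproj_horizontalLift, ← map_sub,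
    covariantDerivative_eq_chartDeriv_add nabla.isCovariantDerivativeOnUniv hY, add_apply,
    sub_neg_eq_add]

lemma mlieBracket_verticalLift_verticalLift {X Y : Π x : M, TangentSpace 𝓘(ℝ, E) x}
    (hX : MDiffAt (T% X) p.1) (hY : MDiffAt (T% Y) p.1) :
    VectorField.mlieBracket 𝓘(ℝ, E).tangent (fun q ↦ verticalLift q (X q.1))
        (fun q ↦ verticalLift q (Y q.1)) p = 0 := by
  rw [mlieBracket_eq_chartDeriv (mdifferentiableAt_verticalLift hsmooth hX)
    (mdifferentiableAt_verticalLift hsmooth hY), chartDeriv_verticalLift hY,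
    chartDeriv_verticalLift hX, dproj_verticalLift, dproj_verticalLift]
  simp

end Brackets

/-! ### The Lee form of the tangent bundle -/

section LeeForm

variable {E : Type*} [NormedAddCommGroup E] [NormedSpace ℝ E] [FiniteDimensional ℝ E]
  {M : Type*} [TopologicalSpace M] [T2Space M] [ChartedSpace E M] [IsManifold 𝓘(ℝ, E) ∞ M]
  {nabla : CovariantDerivative 𝓘(ℝ, E) E (TangentSpace 𝓘(ℝ, E) : M → Type _)}
  (hsmooth : nabla.ContMDiffCovariantDerivative ∞) (htorsion : nabla.torsion = 0)
  (g : ContMDiffRiemannianMetric 𝓘(ℝ, E) ∞ E (TangentSpace 𝓘(ℝ, E) : M → Type _))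

include hsmooth

/-- The metric of `TM` is differentiable, hence has a Levi-Civita connection. -/
lemma isLeviCivita_tangentMetric :
    IsLeviCivita (tangentMetric nabla g.inner) (leviCivita (tangentMetric nabla g.inner)) :=
  isLeviCivita_leviCivita (fun _ ↦ tangentMetric_swap nabla g)
    (fun _ v ↦ tangentMetric_pos nabla g v) (isDifferentiableBilinAt_tangentMetric g hsmooth)

/-- The Lee form of the tangent bundle through the exterior derivative of the fundamental form. -/
lemma leeForm_tangentMetric_eq_sum {p : TangentBundle 𝓘(ℝ, E) M}
    {e : Fin (Module.finrank ℝ E) → Π x : M, TangentSpace 𝓘(ℝ, E) x}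
    (hd : ∀ i, MDiffAt (T% (e i)) p.1) (he : IsOrthonormalAt g.inner p.1 (fun i ↦ e i p.1))
    {W : Π q, TangentSpace 𝓘(ℝ, E).tangent q}
    (hW : MDifferentiableAt 𝓘(ℝ, E).tangent 𝓘(ℝ, E).tangent.tangent
      (fun q ↦ (⟨q, W q⟩ : TangentBundle 𝓘(ℝ, E).tangent (TangentBundle 𝓘(ℝ, E) M))) p) :
    leeForm (complexStructure nabla) (tangentMetric nabla g.inner) p (W p)
      = ∑ i, extDerivTwoForm
        (fundamentalForm (complexStructure nabla) (tangentMetric nabla g.inner))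
        (fun q ↦ horizontalLift nabla q (e i q.1)) (fun q ↦ verticalLift q (e i q.1)) W p := by
  have hLC := isLeviCivita_tangentMetric hsmooth g
  have hskew := fundamentalForm_swap (J := complexStructure nabla)
    (g := tangentMetric nabla g.inner) (fun _ ↦ tangentMetric_swap nabla g)
    (fun _ ↦ complexStructure_complexStructure nabla)
    (fun _ ↦ tangentMetric_complexStructure nabla g)
  rw [leeForm_eq_sum (fun _ ↦ tangentMetric_swap nabla g)
    (fun _ ↦ complexStructure_complexStructure nabla)
    (fun _ ↦ tangentMetric_complexStructure nabla g)
    (isDifferentiableBilinAt_fundamentalForm g hsmooth p)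
    (fun v ↦ ⟨extend (E × E) v, mdifferentiableAt_extend _ _ _,
      mdifferentiableAt_complexStructure hsmooth (mdifferentiableAt_extend _ _ _),
      extend_apply_self _ _⟩)
    (fun _ v ↦ tangentMetric_pos nabla g v) hLC (fun i ↦ horizontalLift nabla p (e i p.1)) ?_ (W p)]
  · refine Finset.sum_congr rfl fun i _ ↦ ?_
    rw [complexStructure_horizontalLift]
    exact cyclic_covDerivBilin (U := fun q ↦ horizontalLift nabla q (e i q.1))
      (V := fun q ↦ verticalLift q (e i q.1)) (W := W) hLC hskew
      (isDifferentiableBilinAt_fundamentalForm g hsmooth p)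
      (mdifferentiableAt_horizontalLift hsmooth (hd i))
      (mdifferentiableAt_verticalLift hsmooth (hd i)) hW
  · intro v
    simp only [complexStructure_horizontalLift, tangentMetric_apply, dproj_horizontalLift,
      connectionMap_horizontalLift, dproj_verticalLift, connectionMap_verticalLift, map_zero,
      add_zero, zero_add, ← map_smul, ← map_sum]
    rw [sum_isOrthonormalAt he, sum_isOrthonormalAt he, horizontalLift_add_verticalLift]

/-- All terms of `dω(X^h, Y^v, Z^v)` vanish, since `ω` vanishes on pairs of vertical vectors,
vertical lifts commute, and functions on `M` are constant along the fibres. -/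
lemma leeForm_verticalLift (p : TangentBundle 𝓘(ℝ, E) M) (w : TangentSpace 𝓘(ℝ, E) p.1) :
    leeForm (complexStructure nabla) (tangentMetric nabla g.inner) p (verticalLift p w) = 0 := by
  have he := isOrthonormalAt_metric g p.1
  have hd (v : TangentSpace 𝓘(ℝ, E) p.1) := mdifferentiableAt_extend 𝓘(ℝ, E) E v
  have h := leeForm_tangentMetric_eq_sum hsmooth g
    (e := fun i ↦ extend E (orthonormalBasisAt g.inner p.1 i)) (fun i ↦ hd _) (by simpa using he)
    (mdifferentiableAt_verticalLift hsmooth (hd w))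
  rw [extend_apply_self] at h
  refine h.trans (Finset.sum_eq_zero fun i _ ↦ ?_)
  set e := orthonormalBasisAt g.inner p.1 i
  have hmetric {X Y : Π x : M, TangentSpace 𝓘(ℝ, E) x} (hX : MDiffAt (T% X) p.1)
      (hY : MDiffAt (T% Y) p.1) := mvfderiv_comp_proj (p := p) (mdifferentiableAt_metric g hX hY)
  have hb := VectorField.mlieBracket_swap_apply (I := 𝓘(ℝ, E).tangent) (x := p)
    (V := fun q ↦ verticalLift q (extend E w q.1))
    (W := fun q : TangentBundle 𝓘(ℝ, E) M ↦ horizontalLift nabla q (extend E e q.1))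
  rw [extDerivTwoForm, hb, mlieBracket_horizontalLift_verticalLift hsmooth (hd e) (hd e),
    mlieBracket_horizontalLift_verticalLift hsmooth (hd e) (hd w),
    mlieBracket_verticalLift_verticalLift hsmooth (hd e) (hd w)]
  simp only [fundamentalForm_tangentMetric, dproj_verticalLift, dproj_horizontalLift,
    connectionMap_verticalLift, connectionMap_horizontalLift, map_zero, zero_apply, map_neg,
    sub_zero, zero_sub, neg_zero, mvfderiv_fun_neg, mvfderiv_const, neg_apply, zero_add]
  rw [hmetric (hd w) (hd e), hmetric (hd e) (hd e), dproj_verticalLift, dproj_verticalLift]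
  simp

include htorsion

/-- By the brackets of lifts,
`dω(X^h, X^v, Z^h) = -X⟨X, Z⟩ + Z⟨X, X⟩ + ⟨∇_X X, Z⟩ - ⟨∇_Z X, X⟩ - ⟨[Z, X], X⟩`, which is
`⟨γ_Z X, X⟩ - ⟨γ_X X, Z⟩` since the Levi-Civita connection is metric and torsion free. -/
lemma leeForm_horizontalLift (p : TangentBundle 𝓘(ℝ, E) M) (v : TangentSpace 𝓘(ℝ, E) p.1) :
    leeForm (complexStructure nabla) (tangentMetric nabla g.inner) p (horizontalLift nabla p v)
      = firstKoszulForm nabla g.inner p.1 v - adjointKoszulForm nabla g.inner p.1 v := by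
  have he := isOrthonormalAt_metric g p.1
  have hd (v : TangentSpace 𝓘(ℝ, E) p.1) := mdifferentiableAt_extend 𝓘(ℝ, E) E v
  have h := leeForm_tangentMetric_eq_sum hsmooth g
    (e := fun i ↦ extend E (orthonormalBasisAt g.inner p.1 i)) (fun i ↦ hd _) (by simpa using he)
    (mdifferentiableAt_horizontalLift hsmooth (hd v))
  rw [extend_apply_self] at h
  rw [h, firstKoszulForm_eq_sum_of_torsion_eq_zero g htorsion he,
    adjointKoszulForm_eq_sum nabla g he, ← Finset.sum_sub_distrib]
  refine Finset.sum_congr rfl fun i _ ↦ ?_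
  set e := orthonormalBasisAt g.inner p.1 i
  have hmetric {X Y : Π x : M, TangentSpace 𝓘(ℝ, E) x} (hX : MDiffAt (T% X) p.1)
      (hY : MDiffAt (T% Y) p.1) := mvfderiv_comp_proj (p := p) (mdifferentiableAt_metric g hX hY)
  have hb := VectorField.mlieBracket_swap_apply (I := 𝓘(ℝ, E).tangent) (x := p)
    (V := fun q : TangentBundle 𝓘(ℝ, E) M ↦ verticalLift q (extend E e q.1))
    (W := fun q ↦ horizontalLift nabla q (extend E v q.1))
  have hh := dproj_mlieBracket (mdifferentiableAt_horizontalLift hsmooth (hd v))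
    (mdifferentiableAt_horizontalLift hsmooth (hd e)) (hd v) (hd e)
    (fun q ↦ dproj_horizontalLift nabla q _) (fun q ↦ dproj_horizontalLift nabla q _)
  have hLC := isLeviCivita_metric g
  have h1 := hLC.metric (hd e) (hd e) (hd v)
  have h2 := hLC.metric (hd v) (hd e) (hd e)
  have h3 := hLC.torsion_free (hd v) (hd e)
  simp only [extend_apply_self] at h1 h2 h3
  rw [extDerivTwoForm, hb, mlieBracket_horizontalLift_verticalLift hsmooth (hd e) (hd e),
    mlieBracket_horizontalLift_verticalLift hsmooth (hd v) (hd e)]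
  simp only [fundamentalForm_tangentMetric, dproj_verticalLift, dproj_horizontalLift,
    connectionMap_verticalLift, connectionMap_horizontalLift, map_zero, zero_apply, map_neg,
    sub_zero, zero_sub, mvfderiv_fun_neg, mvfderiv_const, neg_apply, add_zero, hh]
  rw [hmetric (hd e) (hd v), hmetric (hd e) (hd e), dproj_horizontalLift, dproj_horizontalLift,
    ← h3]
  simp only [extend_apply_self, differenceTensor, map_sub, sub_apply]
  rw [h1, h2, g.symm p.1 e, g.symm p.1 e]
  ring

omit htorsion in
lemma isLinearMap_leeForm (p : TangentBundle 𝓘(ℝ, E) M) :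
    IsLinearMap ℝ (leeForm (complexStructure nabla) (tangentMetric nabla g.inner) p) := by
  choose T hT using exists_covDerivBilin_eq
    (isLeviCivita_tangentMetric hsmooth g).isCovariantDerivative
    (isDifferentiableBilinAt_fundamentalForm g hsmooth p)
  constructor
  · intro v w
    simp only [leeForm, codifferential, hT, map_add, Finset.sum_add_distrib, neg_neg]
  · intro c v
    simp only [leeForm, codifferential, hT, map_smul, ← Finset.smul_sum, neg_neg]

/-- The Lee form of the tangent bundle is the pullback of the difference of the Koszul forms. -/
theorem leeForm_tangentMetric (p : TangentBundle 𝓘(ℝ, E) M)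
    (w : TangentSpace 𝓘(ℝ, E).tangent p) :
    leeForm (complexStructure nabla) (tangentMetric nabla g.inner) p w
      = firstKoszulForm nabla g.inner p.1 (dproj p w)
        - adjointKoszulForm nabla g.inner p.1 (dproj p w) := by
  conv_lhs => rw [← horizontalLift_add_verticalLift nabla p w]
  rw [(isLinearMap_leeForm hsmooth g p).map_add, leeForm_horizontalLift hsmooth htorsion,
    leeForm_verticalLift hsmooth, add_zero]

end LeeForm

/-! ### Pullbacks of 1-forms to the tangent bundle -/

section PullbackOneForm

variable {E : Type*} [NormedAddCommGroup E] [NormedSpace ℝ E] [FiniteDimensional ℝ E]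
  {M : Type*} [TopologicalSpace M] [T2Space M] [ChartedSpace E M] [IsManifold 𝓘(ℝ, E) ∞ M]
  {nabla : CovariantDerivative 𝓘(ℝ, E) E (TangentSpace 𝓘(ℝ, E) : M → Type _)}
  (hsmooth : nabla.ContMDiffCovariantDerivative ∞) {β : OneForm 𝓘(ℝ, E) M}

/-- The pullback of a 1-form by the projection `TM → M`. -/
def pullbackProj (β : OneForm 𝓘(ℝ, E) M) : OneForm 𝓘(ℝ, E).tangent (TangentBundle 𝓘(ℝ, E) M) :=
  fun p w ↦ β p.1 (dproj p w)

include hsmooth in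
lemma isDifferentiableOneFormAt_pullbackProj {p : TangentBundle 𝓘(ℝ, E) M}
    (hβ : IsDifferentiableOneFormAt β p.1) :
    IsDifferentiableOneFormAt (pullbackProj β) p where
  isLinearMap q := ((hβ.isLinearMap q.1).mk' _ ∘ₗ (dproj q).toLinearMap).isLinear
  mdifferentiableAt {V} hV := by
    have hD := isDifferentiableAlongAt_iff.1 ((mdifferentiableAt_tangentBundle_iff hsmooth).1 hV).1
    let b := Module.finBasis ℝ (TangentSpace 𝓘(ℝ, E) p.1)
    have hc (k) : MDifferentiableAt 𝓘(ℝ, E).tangent 𝓘(ℝ) (fun q ↦ b.repr (modelEquiv 𝓘(ℝ, E) p.1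
        (tangentCoord 𝓘(ℝ, E) p.1 q.1 (dproj q (V q)))) k) p := by
      let L : E →L[ℝ] ℝ := ((b.coord k).toContinuousLinearMap).comp
        (modelEquiv 𝓘(ℝ, E) p.1).toContinuousLinearMap
      exact L.mdifferentiableAt.comp (I' := 𝓘(ℝ, E)) p hD
    have hb (k) : MDifferentiableAt 𝓘(ℝ, E).tangent 𝓘(ℝ)
        (fun q : TangentBundle 𝓘(ℝ, E) M ↦ β q.1 (extend E (b k) q.1)) p :=
      MDifferentiableAt.comp (g := fun y ↦ β y (extend E (b k) y)) p
        (hβ.mdifferentiableAt (mdifferentiableAt_extend 𝓘(ℝ, E) E (b k)))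
        (mdifferentiableAt_proj_tangentBundle p)
    refine MDifferentiableAt.congr_of_eventuallyEq
      (mdifferentiableAt_fun_sum Finset.univ fun k _ ↦ (hc k).mul (hb k)).1 ?_
    filter_upwards [eventually_proj_mem_chart_source p] with q hq
    have h := congrArg ((hβ.isLinearMap q.1).mk' _) (eq_sum_repr_smul_extend hq b (dproj q (V q)))
    refine h.trans ?_
    rw [map_sum]
    exact Finset.sum_congr rfl fun k _ ↦ map_smul _ _ _

omit [T2Space M] in
lemma extDerivOneForm_pullbackProj {p : TangentBundle 𝓘(ℝ, E) M}
    (hβ : IsDifferentiableOneFormAt β p.1) {V W : Π q, TangentSpace 𝓘(ℝ, E).tangent q}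
    (hV : MDifferentiableAt 𝓘(ℝ, E).tangent 𝓘(ℝ, E).tangent.tangent
      (fun q ↦ (⟨q, V q⟩ : TangentBundle 𝓘(ℝ, E).tangent (TangentBundle 𝓘(ℝ, E) M))) p)
    (hW : MDifferentiableAt 𝓘(ℝ, E).tangent 𝓘(ℝ, E).tangent.tangent
      (fun q ↦ (⟨q, W q⟩ : TangentBundle 𝓘(ℝ, E).tangent (TangentBundle 𝓘(ℝ, E) M))) p)
    {X Y : Π x : M, TangentSpace 𝓘(ℝ, E) x} (hX : MDiffAt (T% X) p.1) (hY : MDiffAt (T% Y) p.1)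
    (hVX : ∀ q, dproj q (V q) = X q.1) (hWY : ∀ q, dproj q (W q) = Y q.1) :
    extDerivOneForm (pullbackProj β) V W p = extDerivOneForm β X Y p.1 := by
  simp only [extDerivOneForm, pullbackProj, hVX, hWY, dproj_mlieBracket hV hW hX hY hVX hWY]
  rw [mvfderiv_comp_proj (hβ.mdifferentiableAt hX), mvfderiv_comp_proj (hβ.mdifferentiableAt hY),
    hVX, hWY]

include hsmooth in
lemma isClosedOneForm_pullbackProj (hβ : ∀ x, IsDifferentiableOneFormAt β x) :
    IsClosedOneForm (pullbackProj β) ↔ IsClosedOneForm β := by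
  constructor
  · intro h x X Y hX hY
    -- any point of the fibre will do
    have hX' := mdifferentiableAt_horizontalLift (p := ⟨x, 0⟩) hsmooth hX
    have hY' := mdifferentiableAt_horizontalLift (p := ⟨x, 0⟩) hsmooth hY
    rw [← h _ _ _ hX' hY']
    exact (extDerivOneForm_pullbackProj (p := ⟨x, 0⟩) (hβ x) hX' hY' hX hY
      (fun q ↦ dproj_horizontalLift nabla q _) (fun q ↦ dproj_horizontalLift nabla q _)).symm
  · intro h p V W hV hW
    -- a vector field on `TM` that projects to `M` and has the value `u` at `p`
    let L (u : TangentSpace 𝓘(ℝ, E).tangent p) (q : TangentBundle 𝓘(ℝ, E) M) :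
        TangentSpace 𝓘(ℝ, E).tangent q :=
      horizontalLift nabla q (extend E (dproj p u) q.1)
        + verticalLift q (extend E (connectionMap nabla p u) q.1)
    have hL (u) : dproj p (L u p) = dproj p u := by simp [L]
    have hLp (u) : u = L u p := by
      simp only [L, extend_apply_self]
      exact (horizontalLift_add_verticalLift nabla p u).symm
    have hd (v : TangentSpace 𝓘(ℝ, E) p.1) := mdifferentiableAt_extend 𝓘(ℝ, E) E v
    have hLd (u) : MDifferentiableAt 𝓘(ℝ, E).tangent 𝓘(ℝ, E).tangent.tangent
        (fun q ↦ (⟨q, L u q⟩ : TangentBundle 𝓘(ℝ, E).tangent (TangentBundle 𝓘(ℝ, E) M))) p := by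
      rw [mdifferentiableAt_tangentBundle_iff hsmooth]
      simp only [L, map_add, dproj_horizontalLift, connectionMap_horizontalLift,
        dproj_verticalLift, connectionMap_verticalLift, add_zero, zero_add]
      exact ⟨isDifferentiableAlongAt_comp_proj (hd _), isDifferentiableAlongAt_comp_proj (hd _)⟩
    have hLq (u q) : dproj q (L u q) = extend E (dproj p u) q.1 := by simp [L]
    rw [extDerivOneForm_eq_of_eq (isDifferentiableOneFormAt_pullbackProj hsmooth (hβ p.1))
      hV (hLd _) hW (hLd _) (hLp _) (hLp _),
      extDerivOneForm_pullbackProj (hβ p.1) (hLd _) (hLd _) (hd _) (hd _) (hLq _) (hLq _)]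
    exact h _ _ _ (hd _) (hd _)

end PullbackOneForm

end AffineRiemann

end

open AffineRiemann in
theorem mainTheorem2
    {E : Type*} [NormedAddCommGroup E] [NormedSpace ℝ E] [FiniteDimensional ℝ E]
    {M : Type*} [TopologicalSpace M] [T2Space M] [SecondCountableTopology M]
    [ChartedSpace E M] [IsManifold 𝓘(ℝ, E) ∞ M]
    (nabla : CovariantDerivative 𝓘(ℝ, E) E (TangentSpace 𝓘(ℝ, E) : M → Type _))
    (hsmooth : nabla.ContMDiffCovariantDerivative ∞)
    (htorsion : nabla.torsion = 0)
    (hflat : IsFlat nabla)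
    (g : ContMDiffRiemannianMetric 𝓘(ℝ, E) ∞ E (TangentSpace 𝓘(ℝ, E) : M → Type _)) :
    (∀ (p : TangentBundle 𝓘(ℝ, E) M) (w : TangentSpace 𝓘(ℝ, E).tangent p),
        leeForm (complexStructure nabla) (tangentMetric nabla g.inner) p w
          = firstKoszulForm nabla g.inner p.1 (dproj p w)
            - adjointKoszulForm nabla g.inner p.1 (dproj p w)) ∧
    (IsBalanced (complexStructure nabla) (tangentMetric nabla g.inner) ↔
        firstKoszulForm nabla g.inner = adjointKoszulForm nabla g.inner) ∧
    (IsBalanced (complexStructure nabla) (tangentMetric nabla g.inner) ↔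
        ∀ x : M, metricTrace g.inner (fun y v w ↦ adjointDifferenceTensor nabla g.inner y v w
          - differenceTensor nabla g.inner y v w) x = 0) ∧
    (IsLocallyConformallyBalanced (complexStructure nabla) (tangentMetric nabla g.inner) ↔
        IsClosedOneForm (adjointKoszulForm nabla g.inner)) := by
  have hθ := leeForm_tangentMetric hsmooth htorsion g
  have hbal : IsBalanced (complexStructure nabla) (tangentMetric nabla g.inner) ↔
      firstKoszulForm nabla g.inner = adjointKoszulForm nabla g.inner := by
    constructor
    · intro h
      funext x v
      have := h ⟨x, 0⟩ (horizontalLift nabla ⟨x, 0⟩ v)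
      rw [hθ, dproj_horizontalLift] at this
      exact sub_eq_zero.1 this
    · intro h p w
      rw [hθ, h, sub_self]
  refine ⟨hθ, hbal, hbal.trans ?_, ?_⟩
  · have htr (x : M) : metricTrace g.inner (fun y v w ↦ adjointDifferenceTensor nabla g.inner y v w
          - differenceTensor nabla g.inner y v w) x
        = metricTrace g.inner (adjointDifferenceTensor nabla g.inner) x
          - metricTrace g.inner (differenceTensor nabla g.inner) x := by
      simp only [metricTrace, Finset.sum_sub_distrib]
    constructor
    · intro h x
      -- the metric is nondegenerate
      have hv (v : TangentSpace 𝓘(ℝ, E) x) : g.inner x (metricTrace g.inner (fun y v w ↦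
          adjointDifferenceTensor nabla g.inner y v w - differenceTensor nabla g.inner y v w) x) v
          = 0 := by
        rw [htr x, map_sub, sub_apply]
        exact sub_eq_zero.2 (congrFun (congrFun h x) v)
      by_contra hne
      exact (g.pos x _ hne).ne' (hv _)
    · intro h
      funext x v
      have := h x
      rw [htr x, sub_eq_zero] at this
      rw [firstKoszulForm, adjointKoszulForm, this]
  · have hα := isDifferentiableOneFormAt_firstKoszulForm hsmooth htorsion g
    have hξ := isDifferentiableOneFormAt_adjointKoszulForm hsmooth htorsion g
    have hpull : leeForm (complexStructure nabla) (tangentMetric nabla g.inner)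
        = pullbackProj fun x v ↦ firstKoszulForm nabla g.inner x v
          - adjointKoszulForm nabla g.inner x v := by
      funext p w
      exact hθ p w
    rw [IsLocallyConformallyBalanced, hpull,
      isClosedOneForm_pullbackProj hsmooth fun x ↦ (hα x).sub (hξ x)]
    have hclosed := isClosedOneForm_firstKoszulForm hsmooth htorsion g hflat
    refine forall₃_congr fun x X Y ↦ forall₂_congr fun hX hY ↦ ?_
    rw [extDerivOneForm_sub (hα x) (hξ x) hX hY, hclosed x X Y hX hY, zero_sub, neg_eq_zero]
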